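/- Let $p_\infty,p_1:\mathbb R^d\to(0,\infty)$ be probability densities with distributions $P_\infty\neq P_1$. For a density $q$ of a distribution $Q$ put $$\mathcal S_H(x,Q)=\tfrac12\|\nabla\log q(x)\|_2^2+\Delta\log q(x),\qquad D_F(P\|Q)=\tfrac12\,\mathbb E_{X\sim P}\|\nabla\log p(X)-\nabla\log q(X)\|_2^2 .$$ Assume that, for $q\in\{p_1,p_\infty\}$, the functions $q$ and $\nabla\log q$ are differentiable on $\mathbb R^d$, and that $\|\nabla\log q(X)\|_2^2$ and $\mathcal S_H(X,Q)$ are integrable for $X\sim P_1$. On a measurable space let $X_1,X_2,\dots$ be random variables in $\mathbb R^d$ and, for $\nu\in\{1,2,\dots,\infty\}$, let $\mathbb P_\nu$ be a probability measure, with expectation $\mathbb E_\nu$, under which $X_1,X_2,\dots$ are independent, $X_n$ has density $p_\infty$ for $n<\nu$, and $X_n$ has density $p_1$ for $n\ge\nu$. Let $\mathcal F_n=\sigma(X_1,\dots,X_n)$. Fix $\lambda>0$, put $z_\lambda(x)=\lambda\big(\mathcal S_H(x,P_\infty)-\mathcal S_H(x,P_1)\big)$, and assume $\mathbb E_{X\sim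 P_\infty}[\exp z_\lambda(X)]\le1$. For a threshold $\tau$ let $$T_{\mathrm{SCUSUM}}=\inf\Big\{n\ge1:\max_{1\le k\le n}\sum_{i=k}^n z_\lambda(X_i)\ge\tau\Big\}\in\mathbb N\cup\{\infty\}\qquad(\inf\emptyset=\infty),$$ and for a random time $T$ let $$\mathcal L_{\mathrm{WADD}}(T)=\sup_{\nu\ge1}\operatorname{ess\,sup}\mathbb E_\nu[(T-\nu+1)^+\mid\mathcal F_\nu],\qquad \mathcal L_{\mathrm{CADD}}(T)=\sup_{\nu\ge1}\mathbb E_\nu[T-\nu\mid T\ge\nu],$$ where $\nu$ ranges over the positive integers. Theorem. Take $\tau=\log\gamma$. Then the constraint $\mathbb E_\infty[T_{\mathrm{SCUSUM}}]\ge\gamma$ holds for every $\gamma>1$, and, as $\gamma\to\infty$, $$\mathcal L_{\mathrm{WADD}}(T_{\mathrm{SCUSUM}})\sim\mathcal L_{\mathrm{CADD}}(T_{\mathrm{SCUSUM}})\sim\mathbb E_1[T_{\mathrm{SCUSUM}}]\sim\frac{\log\gamma}{\lambda\,D_F(P_1\|P_\infty)},$$ where $g\sim h$ means $g/h\to1$.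 -/

import Mathlib

open MeasureTheory ProbabilityTheory Filter Asymptotics
open scoped ENNReal

namespace SCUSUM

noncomputable section

/-- `p` is a probability density on `ℝ^d` with respect to Lebesgue measure, positive everywhere
(so that `log p` makes sense). -/
structure IsPositiveDensity {d : ℕ} (p : EuclideanSpace ℝ (Fin d) → ℝ) : Prop where
  pos : ∀ x, 0 < p x
  lintegral_eq_one : ∫⁻ x, ENNReal.ofReal (p x) = 1

/-- The distribution on `ℝ^d` with density `p`. -/
def law {d : ℕ} (p : EuclideanSpace ℝ (Fin d) → ℝ) : Measure (EuclideanSpace ℝ (Fin d)) :=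
  volume.withDensity fun x => ENNReal.ofReal (p x)

/-- The score `∇ₓ log q`. -/
def gradLog {d : ℕ} (q : EuclideanSpace ℝ (Fin d) → ℝ) (x : EuclideanSpace ℝ (Fin d)) :
    EuclideanSpace ℝ (Fin d) :=
  gradient (fun y => Real.log (q y)) x

/-- The Hyvärinen score `S_H(x, Q) = ½ ‖∇ log q(x)‖² + Δ log q(x)`. -/
def hyvarinenScore {d : ℕ} (q : EuclideanSpace ℝ (Fin d) → ℝ)
    (x : EuclideanSpace ℝ (Fin d)) : ℝ :=
  1 / 2 * ‖gradLog q x‖ ^ 2 + Laplacian.laplacian (fun y => Real.log (q y)) x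

/-- The Fisher divergence `D_F(P‖Q) = ½ E_{X∼P} ‖∇ log p(X) - ∇ log q(X)‖²`. -/
def fisherDivergence {d : ℕ} (p q : EuclideanSpace ℝ (Fin d) → ℝ) : ℝ :=
  1 / 2 * ∫ x, ‖gradLog p x - gradLog q x‖ ^ 2 ∂(law p)

/-- Regularity conditions of score matching, with data density `p` and model density `q`:
`p`, `q` and the score `∇ log q` are differentiable, both scores have a finite second moment
under the data distribution, and `S_H(X, Q)` is integrable under it. -/
structure ScoreRegular {d : ℕ} (p q : EuclideanSpace ℝ (Fin d) → ℝ) : Prop where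
  differentiable_data : Differentiable ℝ p
  differentiable_model : Differentiable ℝ q
  differentiable_score : Differentiable ℝ (gradLog q)
  integrable_data_score : Integrable (fun x => ‖gradLog p x‖ ^ 2) (law p)
  integrable_model_score : Integrable (fun x => ‖gradLog q x‖ ^ 2) (law p)
  integrable_hyvarinenScore : Integrable (hyvarinenScore q) (law p)

/-- The instantaneous SCUSUM score `z_λ(x) = λ (S_H(x, P_∞) - S_H(x, P_1))`. -/
def instScore {d : ℕ} (pInf p1 : EuclideanSpace ℝ (Fin d) → ℝ) (lam : ℝ)
    (x : EuclideanSpace ℝ (Fin d)) : ℝ :=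
  lam * (hyvarinenScore pInf x - hyvarinenScore p1 x)

/-- The change-point model: under `P ν` (with `ν ∈ {1, 2, …, ∞}`) the observations
`X 1, X 2, …` are independent, with density `pInf` before time `ν` and density `p1` from time `ν`
on. The value `X 0` plays no role. -/
structure IsChangePointModel {d : ℕ} {Ω : Type*} [MeasurableSpace Ω]
    (pInf p1 : EuclideanSpace ℝ (Fin d) → ℝ) (P : ℕ∞ → Measure Ω)
    (X : ℕ → Ω → EuclideanSpace ℝ (Fin d)) : Prop where
  isProbabilityMeasure : ∀ ν : ℕ∞, 1 ≤ ν → IsProbabilityMeasure (P ν)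
  measurable : ∀ n : ℕ, 1 ≤ n → Measurable (X n)
  iIndepFun : ∀ ν : ℕ∞, 1 ≤ ν → iIndepFun (fun n : ℕ => X (n + 1)) (P ν)
  law_before : ∀ (ν : ℕ∞) (n : ℕ), 1 ≤ n → (n : ℕ∞) < ν → (P ν).map (X n) = law pInf
  law_after : ∀ (ν : ℕ∞) (n : ℕ), 1 ≤ ν → ν ≤ (n : ℕ∞) → (P ν).map (X n) = law p1

/-- The `σ`-algebra `F_n` generated by `X 1, …, X n`. -/
abbrev pastSigma {Ω E : Type*} [MeasurableSpace E] (X : ℕ → Ω → E) (n : ℕ) : MeasurableSpace Ω :=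
  ⨆ i ∈ Finset.Icc 1 n, MeasurableSpace.comap (X i) inferInstance

/-- The stopping time `inf {n ≥ 1 : max_{1 ≤ k ≤ n} ∑_{i=k}^n z (X i) ≥ τ}`, with values in
`ℕ ∪ {∞}`; the infimum of the empty set is `∞`. -/
def stoppingTime {Ω E : Type*} (z : E → ℝ) (τ : ℝ) (X : ℕ → Ω → E) (ω : Ω) : ℕ∞ :=
  sInf ((fun n : ℕ => (n : ℕ∞)) ''
    {n : ℕ | 1 ≤ n ∧ ∃ k ∈ Finset.Icc 1 n, τ ≤ ∑ i ∈ Finset.Icc k n, z (X i ω)})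

/-- The expectation, in `[0, ∞]`, of a random time. -/
def expTime {Ω : Type*} [MeasurableSpace Ω] (μ : Measure Ω) (T : Ω → ℕ∞) : ℝ≥0∞ :=
  ∫⁻ ω, ((T ω : ℕ∞) : ℝ≥0∞) ∂μ

/-- Lorden's worst-case averaged detection delay
`sup_{ν ≥ 1} ess sup E_ν[(T - ν + 1)⁺ | F_ν]`. The subtraction in `ℕ∞` is truncated at `0`, so
`T + 1 - ν` is the positive part. -/
def wadd {Ω E : Type*} [MeasurableSpace Ω] [MeasurableSpace E] (P : ℕ∞ → Measure Ω)
    (X : ℕ → Ω → E) (T : Ω → ℕ∞) : ℝ≥0∞ :=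
  ⨆ (ν : ℕ) (_ : 1 ≤ ν),
    essSup (condLExp (pastSigma X ν) (P ν) fun ω => ((T ω + 1 - (ν : ℕ∞) : ℕ∞) : ℝ≥0∞)) (P ν)

/-- Pollak's worst conditional averaged detection delay `sup_{ν ≥ 1} E_ν[T - ν | T ≥ ν]`. -/
def cadd {Ω : Type*} [MeasurableSpace Ω] (P : ℕ∞ → Measure Ω) (T : Ω → ℕ∞) : ℝ≥0∞ :=
  ⨆ (ν : ℕ) (_ : 1 ≤ ν),
    expTime (cond (P ν) {ω | (ν : ℕ∞) ≤ T ω}) fun ω => T ω - (ν : ℕ∞)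

end

end SCUSUM

namespace SCUSUM

/-! Write `z` for the instantaneous score and `τ = log γ`. Integration by parts against `p1`
(`ScoreRegular.integral_hyvarinenScore`) gives `z` the post-change mean `m = λ D_F(P₁‖P_∞)`, and `m
> 0` because the two laws differ. After the change the walk with increments `z` thus climbs at rate
`m` and needs about `τ / m` steps to gain `τ`.

False alarms: with no change `exp z` has mean at most one, so `R_n - n` is a supermartingale for the
Shiryaev–Roberts statistic `R`. Since `R` dominates the exponential of every scanned sum, `R ≥ γ` at
the alarm, and optional stopping gives mean time at least `γ` (`le_expTime_stoppingTime`).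

Upper bounds: scanning only from `ν + 1` can only postpone the alarm, and that walk is independent
of `F_ν`. Hence, uniformly in `ν`, both delays are at most one plus a mean first passage time.
Wald's identity for increments cut off at `b`, which caps the overshoot, bounds the latter by `(τ +
b) / E[min(z, b)]` (`lintegral_passageTime_le`); then `τ → ∞` with `b` fixed, and `b → ∞` last.

Lower bounds: taking `ν = 1`, both criteria are at least `E_1[T] - 1`. By the strong law, with
probability close to one all partial sums stay in a narrow linear cone around slope `m`, so no
segment gains `τ` much before `τ / m` (`exists_le_expTime_stoppingTime`). -/

/-! ### Divergence theorem on the whole space -/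

/-- The divergence of a vector field on `ℝ^d`. -/
noncomputable def divergence {d : ℕ} (F : EuclideanSpace ℝ (Fin d) → EuclideanSpace ℝ (Fin d))
    (x : EuclideanSpace ℝ (Fin d)) : ℝ :=
  ∑ i, fderiv ℝ F x (EuclideanSpace.single i 1) i

theorem measurable_divergence {d : ℕ}
    (F : EuclideanSpace ℝ (Fin d) → EuclideanSpace ℝ (Fin d)) : Measurable (divergence F) := by
  refine Finset.measurable_sum _ fun i _ => ?_
  have h := measurable_fderiv_apply_const ℝ F (EuclideanSpace.single i (1 : ℝ))
  exact (EuclideanSpace.proj (𝕜 := ℝ) i).continuous.measurable.comp h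

/-- On a box larger than the support all face terms vanish. The box version of the theorem asks for
differentiability and an integrable divergence only, so the field need not be `C¹`. -/
theorem integral_divergence_eq_zero_of_hasCompactSupport {d : ℕ}
    {F : EuclideanSpace ℝ (Fin d) → EuclideanSpace ℝ (Fin d)} (hF : Differentiable ℝ F)
    (hc : HasCompactSupport F) (hi : Integrable (divergence F)) :
    ∫ x, divergence F x = 0 := by
  cases d with
  | zero => simp [divergence]
  | succ n =>
    let eL := PiLp.continuousLinearEquiv 2 ℝ (fun _ : Fin (n + 1) => ℝ)
    let f : (Fin (n + 1) → ℝ) → (Fin (n + 1) → ℝ) := fun y => eL (F (eL.symm y))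
    let f' : (Fin (n + 1) → ℝ) → (Fin (n + 1) → ℝ) →L[ℝ] (Fin (n + 1) → ℝ) := fun y =>
      (eL : EuclideanSpace ℝ (Fin (n + 1)) →L[ℝ] (Fin (n + 1) → ℝ)) ∘L
        (fderiv ℝ F (eL.symm y)) ∘L
          (eL.symm : (Fin (n + 1) → ℝ) →L[ℝ] EuclideanSpace ℝ (Fin (n + 1)))
    have hf : ∀ y, HasFDerivAt f (f' y) y := fun y =>
      eL.hasFDerivAt.comp y ((hF (eL.symm y)).hasFDerivAt.comp y eL.symm.hasFDerivAt)
    have hdiv : ∀ y, ∑ i, f' y (Pi.single i 1) i = divergence F (WithLp.toLp 2 y) := by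
      intro y; rfl
    obtain ⟨R, hR⟩ := hc.isCompact.isBounded.subset_closedBall 0
    have hzero : ∀ x, R < ‖x‖ → F x = 0 := by
      intro x hx
      by_contra h
      have := hR (subset_tsupport _ (Function.mem_support.2 h))
      rw [mem_closedBall_zero_iff] at this
      linarith
    have hdivzero : ∀ x, R < ‖x‖ → divergence F x = 0 := by
      intro x hx
      have : fderiv ℝ F x = 0 := by
        by_contra h
        have := hR (support_fderiv_subset ℝ (Function.mem_support.2 h))
        rw [mem_closedBall_zero_iff] at this
        linarith
      simp [divergence, this]
    -- `R` may be negative when the support is empty, while the box needs a positive half-side.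
    let r : ℝ := |R| + 1
    have hr : R < r := (le_abs_self R).trans_lt (lt_add_one _)
    have hr0 : 0 < r := by positivity
    have hcoord : ∀ (y : Fin (n + 1) → ℝ) (i : Fin (n + 1)), r ≤ |y i| →
        R < ‖(WithLp.toLp 2 y : EuclideanSpace ℝ (Fin (n + 1)))‖ := by
      intro y i h
      have := PiLp.norm_apply_le (WithLp.toLp 2 y : EuclideanSpace ℝ (Fin (n + 1))) i
      simp only [Real.norm_eq_abs] at this
      linarith
    have hmp := PiLp.volume_preserving_toLp (Fin (n + 1))
    have hiy : Integrable (fun y : Fin (n + 1) → ℝ => divergence F (WithLp.toLp 2 y)) :=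
      hmp.integrable_comp_of_integrable hi
    have key := integral_divergence_of_hasFDerivAt_off_countable (fun _ : Fin (n + 1) => -r)
      (fun _ => r) (fun _ => by linarith) f f' ∅ Set.countable_empty
      (fun y _ => (hf y).continuousAt.continuousWithinAt) (fun y _ => hf y)
      (by simp only [hdiv]; exact hiy.integrableOn)
    have hface : ∀ (y : Fin (n + 1) → ℝ) (i : Fin (n + 1)), r ≤ |y i| → f y = 0 := by
      intro y i h
      have : F (WithLp.toLp 2 y) = 0 := hzero _ (hcoord y i h)
      change eL (F (WithLp.toLp 2 y)) = 0
      rw [this, map_zero]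
    have hfront : ∀ (i : Fin (n + 1)) (y : Fin n → ℝ), f (i.insertNth r y) = 0 := fun i y =>
      hface _ i (by simp [abs_of_pos hr0])
    have hback : ∀ (i : Fin (n + 1)) (y : Fin n → ℝ), f (i.insertNth (-r) y) = 0 := fun i y =>
      hface _ i (by simp [abs_of_pos hr0])
    simp only [hfront, hback, hdiv, Pi.zero_apply, integral_zero, sub_self,
      Finset.sum_const_zero] at key
    rw [setIntegral_eq_integral_of_forall_compl_eq_zero] at key
    · rw [← key]
      exact (hmp.integral_comp (MeasurableEquiv.toLp 2 _).measurableEmbedding _).symm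
    · intro y hy
      have : ∃ i, r ≤ |y i| := by
        by_contra! h
        exact hy ⟨fun i => (abs_lt.1 (h i)).1.le, fun i => (abs_lt.1 (h i)).2.le⟩
      obtain ⟨i, h⟩ := this
      exact hdivzero _ (hcoord y i h)

theorem divergence_smul {d : ℕ} {g : EuclideanSpace ℝ (Fin d) → ℝ}
    {F : EuclideanSpace ℝ (Fin d) → EuclideanSpace ℝ (Fin d)} {x : EuclideanSpace ℝ (Fin d)}
    (hg : DifferentiableAt ℝ g x) (hF : DifferentiableAt ℝ F x) :
    divergence (fun y => g y • F y) x = g x * divergence F x + fderiv ℝ g x (F x) := by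
  have h := (hg.hasFDerivAt.smul hF.hasFDerivAt).fderiv
  have hx : F x = ∑ i, (F x i) • EuclideanSpace.single i (1 : ℝ) := by
    simpa using ((EuclideanSpace.basisFun (Fin d) ℝ).sum_repr (F x)).symm
  have h2 : fderiv ℝ g x (F x) = ∑ i, F x i * fderiv ℝ g x (EuclideanSpace.single i 1) := by
    conv_lhs => rw [hx]
    simp
  rw [h2]
  unfold divergence
  change fderiv ℝ (fun y => g y • F y) x = _ at h
  rw [h, Finset.mul_sum, ← Finset.sum_add_distrib]
  refine Finset.sum_congr rfl fun i _ => ?_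
  simp [mul_comm]

/-- Cut off with `b (x / (n + 1))`: the extra term, the derivative of the cutoff applied to `F`,
carries a factor `1 / (n + 1)` and is dominated by `C ‖F‖`, so it disappears in the limit. -/
theorem integral_divergence_eq_zero {d : ℕ}
    {F : EuclideanSpace ℝ (Fin d) → EuclideanSpace ℝ (Fin d)} (hF : Differentiable ℝ F)
    (hFi : Integrable F) (hi : Integrable (divergence F)) :
    ∫ x, divergence F x = 0 := by
  let b : ContDiffBump (0 : EuclideanSpace ℝ (Fin d)) := ⟨1, 2, one_pos, one_lt_two⟩
  have hbd : ContDiff ℝ 1 b := b.contDiff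
  obtain ⟨C, hC⟩ : ∃ C, ∀ x, ‖fderiv ℝ b x‖ ≤ C :=
    (b.hasCompactSupport.fderiv ℝ).exists_bound_of_continuous (hbd.continuous_fderiv one_ne_zero)
  have hb1 : Differentiable ℝ b := hbd.differentiable one_ne_zero
  let s : ℕ → ℝ := fun n => ((n : ℝ) + 1)⁻¹
  have hs0 : ∀ n, 0 < s n := fun n => by positivity
  have hs1 : ∀ n, s n ≤ 1 := fun n => inv_le_one_of_one_le₀ (by simp)
  have hs : Tendsto s atTop (nhds 0) := tendsto_inv_atTop_nhds_zero_nat.comp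
    (tendsto_add_atTop_nat 1) |>.congr fun n => by simp [s]
  let χ : ℕ → EuclideanSpace ℝ (Fin d) → ℝ := fun n x => b (s n • x)
  have hχ : ∀ n x, HasFDerivAt (χ n) (s n • fderiv ℝ b (s n • x)) x := by
    intro n x
    have h1 : HasFDerivAt (fun y : EuclideanSpace ℝ (Fin d) => s n • y)
      (s n • ContinuousLinearMap.id ℝ (EuclideanSpace ℝ (Fin d))) x :=
        (hasFDerivAt_id x).const_smul (s n)
    have := (hb1 (s n • x)).hasFDerivAt.comp x h1
    rw [ContinuousLinearMap.comp_smul, ContinuousLinearMap.comp_id] at this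
    exact this
  have hχd : ∀ n, Differentiable ℝ (χ n) := fun n x => (hχ n x).differentiableAt
  have hdiv : ∀ n x, divergence (fun y => χ n y • F y) x =
      χ n x * divergence F x + s n * fderiv ℝ b (s n • x) (F x) := by
    intro n x
    rw [divergence_smul (hχd n x) (hF x), (hχ n x).fderiv]
    simp
  have hbound : ∀ n x, ‖divergence (fun y => χ n y • F y) x‖ ≤
      ‖divergence F x‖ + C * ‖F x‖ := by
    intro n x
    rw [hdiv]
    refine (norm_add_le _ _).trans (add_le_add ?_ ?_)
    · rw [norm_mul]
      refine mul_le_of_le_one_left (norm_nonneg _) ?_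
      rw [Real.norm_of_nonneg b.nonneg]
      exact b.le_one
    · rw [norm_mul, Real.norm_of_nonneg (hs0 n).le]
      refine (mul_le_of_le_one_left (norm_nonneg _) (hs1 n)).trans ?_
      exact (ContinuousLinearMap.le_opNorm _ _).trans
        (mul_le_mul_of_nonneg_right (hC _) (norm_nonneg _))
  have hdom : Integrable fun x => ‖divergence F x‖ + C * ‖F x‖ :=
    hi.norm.add (hFi.norm.const_mul C)
  have hzero : ∀ n, ∫ x, divergence (fun y => χ n y • F y) x = 0 := by
    intro n
    refine integral_divergence_eq_zero_of_hasCompactSupport (fun x => (hχd n x).smul (hF x)) ?_ ?_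
    · have : HasCompactSupport (χ n) :=
        b.hasCompactSupport.comp_homeomorph (Homeomorph.smulOfNeZero (s n) (hs0 n).ne')
      exact this.smul_right
    · exact hdom.mono' (measurable_divergence _).aestronglyMeasurable
        (ae_of_all _ fun x => hbound n x)
  have hlim : Tendsto (fun n => ∫ x, divergence (fun y => χ n y • F y) x) atTop
      (nhds (∫ x, divergence F x)) := by
    refine tendsto_integral_of_dominated_convergence _
      (fun n => (measurable_divergence _).aestronglyMeasurable) hdom
      (fun n => ae_of_all _ fun x => hbound n x) (ae_of_all _ fun x => ?_)
    simp only [hdiv]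
    have h1 : Tendsto (fun n => s n • x) atTop (nhds (0 : EuclideanSpace ℝ (Fin d))) := by
      simpa using hs.smul_const x
    have h2 : Tendsto (fun n => χ n x) atTop (nhds 1) := by
      have := (b.continuous.tendsto 0).comp h1
      rwa [b.one_of_mem_closedBall (by simp [b.rIn_pos.le])] at this
    have h3 : Tendsto (fun n => fderiv ℝ b (s n • x) (F x)) atTop
        (nhds (fderiv ℝ b 0 (F x))) :=
      (((hbd.continuous_fderiv one_ne_zero).clm_apply continuous_const).tendsto 0).comp h1
    simpa using (h2.mul_const (divergence F x)).add (hs.mul h3)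
  simp only [hzero] at hlim
  exact (tendsto_nhds_unique hlim tendsto_const_nhds)

/-! ### Score matching and the drift of the score -/

theorem gradient_apply_eq {d : ℕ} (f : EuclideanSpace ℝ (Fin d) → ℝ)
    (x : EuclideanSpace ℝ (Fin d)) (i : Fin d) :
    gradient f x i = fderiv ℝ f x (EuclideanSpace.single i 1) := by
  rw [← inner_gradient_left, EuclideanSpace.inner_single_right]
  simp

/-- Differentiability of the gradient at the single point suffices, since `fderiv` is a fixed linear
image of the gradient. -/
theorem laplacian_eq_divergence_gradient {d : ℕ} {f : EuclideanSpace ℝ (Fin d) → ℝ}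
    {x : EuclideanSpace ℝ (Fin d)} (h : DifferentiableAt ℝ (gradient f) x) :
    Laplacian.laplacian f x = divergence (gradient f) x := by
  have hf : DifferentiableAt ℝ (fderiv ℝ f) x := by
    have : fderiv ℝ f = fun y => ∑ i, gradient f y i • EuclideanSpace.proj (𝕜 := ℝ) i := by
      ext y v
      simp [← inner_gradient_left, PiLp.inner_apply, mul_comm]
    rw [this]
    fun_prop
  rw [InnerProductSpace.laplacian_eq_iteratedFDeriv_orthonormalBasis f
    (EuclideanSpace.basisFun (Fin d) ℝ)]
  unfold divergence
  refine Finset.sum_congr rfl fun i _ => ?_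
  simp only [EuclideanSpace.basisFun_apply]
  rw [iteratedFDeriv_two_apply]
  have h1 : HasFDerivAt (fun y => fderiv ℝ f y (EuclideanSpace.single i 1))
      ((fderiv ℝ (fderiv ℝ f) x).flip (EuclideanSpace.single i 1)) x :=
    hf.hasFDerivAt.clm_apply (hasFDerivAt_const _ _) |>.congr_fderiv (by simp)
  have h2 : HasFDerivAt (fun y => gradient f y i)
      (EuclideanSpace.proj (𝕜 := ℝ) i ∘L fderiv ℝ (gradient f) x) x :=
    (EuclideanSpace.proj (𝕜 := ℝ) i).hasFDerivAt.comp x h.hasFDerivAt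
  simp only [gradient_apply_eq] at h2
  have := congrArg (fun L => L (EuclideanSpace.single i 1)) (h1.unique h2)
  simpa using this

theorem measurable_gradient {d : ℕ} (f : EuclideanSpace ℝ (Fin d) → ℝ) :
    Measurable (gradient f) := by
  have h : ∀ i, Measurable fun x => gradient f x i := fun i => by
    simp only [gradient_apply_eq]
    exact measurable_fderiv_apply_const ℝ f _
  exact (MeasurableEquiv.toLp 2 _).measurable.comp (measurable_pi_lambda _ h)

theorem measurable_gradLog {d : ℕ} (q : EuclideanSpace ℝ (Fin d) → ℝ) :
    Measurable (gradLog q) :=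
  measurable_gradient _

theorem measurable_hyvarinenScore {d : ℕ} (q : EuclideanSpace ℝ (Fin d) → ℝ) :
    Measurable (hyvarinenScore q) := by
  have h : Measurable (Laplacian.laplacian fun y => Real.log (q y)) := by
    rw [InnerProductSpace.laplacian_eq_iteratedFDeriv_orthonormalBasis _
      (EuclideanSpace.basisFun (Fin d) ℝ)]
    refine Finset.measurable_sum _ fun i _ => ?_
    simp only [iteratedFDeriv_two_apply]
    exact (ContinuousLinearMap.measurable_apply _).comp (measurable_fderiv_apply_const ℝ
      (fderiv ℝ fun y => Real.log (q y)) _)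
  exact (((measurable_gradLog q).norm.pow_const 2).const_mul _).add h

theorem measurable_instScore {d : ℕ} (pInf p1 : EuclideanSpace ℝ (Fin d) → ℝ) (lam : ℝ) :
    Measurable (instScore pInf p1 lam) :=
  ((measurable_hyvarinenScore pInf).sub (measurable_hyvarinenScore p1)).const_mul lam

theorem isProbabilityMeasure_law {d : ℕ} {p : EuclideanSpace ℝ (Fin d) → ℝ}
    (hp : IsPositiveDensity p) : IsProbabilityMeasure (law p) :=
  ⟨by rw [law, withDensity_apply _ .univ, Measure.restrict_univ, hp.lintegral_eq_one]⟩

theorem integrable_law_iff {d : ℕ} {p : EuclideanSpace ℝ (Fin d) → ℝ}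
    (hp : IsPositiveDensity p) (hpc : Continuous p) {E : Type*} [NormedAddCommGroup E]
    [NormedSpace ℝ E] {f : EuclideanSpace ℝ (Fin d) → E} :
    Integrable f (law p) ↔ Integrable fun x => p x • f x := by
  rw [law, integrable_withDensity_iff_integrable_smul' hpc.measurable.ennreal_ofReal
    (ae_of_all _ fun x => ENNReal.ofReal_lt_top)]
  simp only [ENNReal.toReal_ofReal (hp.pos _).le]

theorem integral_law {d : ℕ} {p : EuclideanSpace ℝ (Fin d) → ℝ}
    (hp : IsPositiveDensity p) (hpc : Continuous p) (f : EuclideanSpace ℝ (Fin d) → ℝ) :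
    ∫ x, f x ∂(law p) = ∫ x, p x * f x := by
  rw [law, integral_withDensity_eq_integral_toReal_smul hpc.measurable.ennreal_ofReal
    (ae_of_all _ fun x => ENNReal.ofReal_lt_top)]
  simp only [ENNReal.toReal_ofReal (hp.pos _).le, smul_eq_mul]

theorem fderiv_eq_mul_inner_gradLog {d : ℕ} {p : EuclideanSpace ℝ (Fin d) → ℝ}
    (hp : IsPositiveDensity p) (hpd : Differentiable ℝ p) (x v : EuclideanSpace ℝ (Fin d)) :
    fderiv ℝ p x v = p x * inner ℝ (gradLog p x) v := by
  rw [gradLog, inner_gradient_left, fderiv.log (hpd x) (hp.pos x).ne']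
  simp [mul_inv_cancel_left₀ (hp.pos x).ne']

theorem integrable_inner_of_sq {α E : Type*} [MeasurableSpace α] {μ : Measure α}
    [NormedAddCommGroup E] [InnerProductSpace ℝ E] {f g : α → E}
    (hf : AEStronglyMeasurable f μ) (hg : AEStronglyMeasurable g μ)
    (hf2 : Integrable (fun x => ‖f x‖ ^ 2) μ) (hg2 : Integrable (fun x => ‖g x‖ ^ 2) μ) :
    Integrable (fun x => inner ℝ (f x) (g x)) μ := by
  refine (hf2.add hg2).mono' (hf.inner hg) (ae_of_all _ fun x => ?_)
  refine (norm_inner_le_norm _ _).trans ?_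
  simp only [Pi.add_apply]
  nlinarith [sq_nonneg (‖f x‖ - ‖g x‖), sq_nonneg ‖f x‖, sq_nonneg ‖g x‖]

theorem ScoreRegular.integrable_inner {d : ℕ} {p q : EuclideanSpace ℝ (Fin d) → ℝ}
    (h : ScoreRegular p q) :
    Integrable (fun x => inner ℝ (gradLog p x) (gradLog q x)) (law p) :=
  integrable_inner_of_sq (measurable_gradLog p).aestronglyMeasurable
    (measurable_gradLog q).aestronglyMeasurable h.integrable_data_score h.integrable_model_score

/-- Score matching: the Laplacian term of the Hyvärinen score is an inner product of scores
in the mean. -/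
theorem ScoreRegular.integral_hyvarinenScore {d : ℕ} {p q : EuclideanSpace ℝ (Fin d) → ℝ}
    (hp : IsPositiveDensity p) (h : ScoreRegular p q) :
    ∫ x, hyvarinenScore q x ∂(law p) =
      ∫ x, (1 / 2 * ‖gradLog q x‖ ^ 2 - inner ℝ (gradLog p x) (gradLog q x)) ∂(law p) := by
  have hprob := isProbabilityMeasure_law hp
  have hpc := h.differentiable_data.continuous
  let F := fun x => p x • gradLog q x
  have hFd : Differentiable ℝ F := h.differentiable_data.smul h.differentiable_score
  -- `D` equals `Δ log q + ⟨∇ log p, ∇ log q⟩`, and `p D` is the divergence of `F = p ∇ log q`. This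
  -- form shows integrability of `D` directly from that of the score and of the squared gradients.
  let D := fun x => hyvarinenScore q x -
    (1 / 2 * ‖gradLog q x‖ ^ 2 - inner ℝ (gradLog p x) (gradLog q x))
  have hm : Integrable (fun x => 1 / 2 * ‖gradLog q x‖ ^ 2 -
      inner ℝ (gradLog p x) (gradLog q x)) (law p) :=
    (h.integrable_model_score.const_mul _).sub h.integrable_inner
  have hDi : Integrable D (law p) := h.integrable_hyvarinenScore.sub hm
  have hdiv : divergence F = fun x => p x * D x := by
    ext x
    rw [divergence_smul (h.differentiable_data x) (h.differentiable_score x),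
      fderiv_eq_mul_inner_gradLog hp h.differentiable_data]
    have : divergence (gradLog q) x = Laplacian.laplacian (fun y => Real.log (q y)) x :=
      (laplacian_eq_divergence_gradient (h.differentiable_score x)).symm
    simp only [this, D, hyvarinenScore]
    ring
  have hg : Integrable (gradLog q) (law p) := by
    refine ((integrable_const (1 : ℝ)).add h.integrable_model_score).mono'
      (measurable_gradLog q).aestronglyMeasurable (ae_of_all _ fun x => ?_)
    simp only [Pi.add_apply]
    nlinarith [sq_nonneg (‖gradLog q x‖ - 1)]
  have hzero := integral_divergence_eq_zero hFd ((integrable_law_iff hp hpc).1 hg)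
    (by rw [hdiv]; exact (integrable_law_iff hp hpc).1 hDi)
  rw [hdiv, ← integral_law hp hpc, integral_sub h.integrable_hyvarinenScore hm, sub_eq_zero]
    at hzero
  exact hzero

theorem integrable_instScore {d : ℕ} {pInf p1 : EuclideanSpace ℝ (Fin d) → ℝ}
    (hreg1 : ScoreRegular p1 p1) (hregInf : ScoreRegular p1 pInf) (lam : ℝ) :
    Integrable (instScore pInf p1 lam) (law p1) :=
  (hregInf.integrable_hyvarinenScore.sub hreg1.integrable_hyvarinenScore).const_mul lam

/-- With the Laplacians replaced by inner products, the difference of the two means completes the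
square `½ ‖∇ log p1 - ∇ log pInf‖²`. -/
theorem integral_instScore {d : ℕ} {pInf p1 : EuclideanSpace ℝ (Fin d) → ℝ}
    (hp1 : IsPositiveDensity p1) (hreg1 : ScoreRegular p1 p1) (hregInf : ScoreRegular p1 pInf)
    (lam : ℝ) :
    ∫ x, instScore pInf p1 lam x ∂(law p1) = lam * fisherDivergence p1 pInf := by
  unfold instScore fisherDivergence
  rw [integral_const_mul, integral_sub hregInf.integrable_hyvarinenScore
    hreg1.integrable_hyvarinenScore, hregInf.integral_hyvarinenScore hp1,
    hreg1.integral_hyvarinenScore hp1, ← integral_sub, ← integral_const_mul (1 / 2)]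
  · congr 1
    refine integral_congr_ae (ae_of_all _ fun x => ?_)
    simp only [real_inner_self_eq_norm_sq, norm_sub_sq_real]
    ring
  · exact (hregInf.integrable_model_score.const_mul _).sub hregInf.integrable_inner
  · exact (hreg1.integrable_model_score.const_mul _).sub hreg1.integrable_inner

/-- If it vanished, the scores would agree almost everywhere, hence everywhere by continuity; the
log-ratio would be constant, and normalisation would make the densities equal. -/
theorem fisherDivergence_pos {d : ℕ} {pInf p1 : EuclideanSpace ℝ (Fin d) → ℝ}
    (hpInf : IsPositiveDensity pInf) (hp1 : IsPositiveDensity p1) (hne : law p1 ≠ law pInf)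
    (hreg1 : ScoreRegular p1 p1) (hregInf : ScoreRegular p1 pInf) :
    0 < fisherDivergence p1 pInf := by
  have hnn : 0 ≤ fisherDivergence p1 pInf := by unfold fisherDivergence; positivity
  refine hnn.lt_of_ne fun h0 => hne ?_
  have hpc := hreg1.differentiable_data.continuous
  have hint : Integrable (fun x => ‖gradLog p1 x - gradLog pInf x‖ ^ 2) (law p1) := by
    refine ((hregInf.integrable_data_score.sub
      (hregInf.integrable_inner.const_mul 2)).add hregInf.integrable_model_score).congr
      (ae_of_all _ fun x => ?_)
    simp only [norm_sub_sq_real, Pi.add_apply, Pi.sub_apply]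
  have hz : ∫ x, ‖gradLog p1 x - gradLog pInf x‖ ^ 2 ∂(law p1) = 0 := by
    unfold fisherDivergence at h0; linarith
  rw [integral_law hp1 hpc, integral_eq_zero_iff_of_nonneg
    (fun x => mul_nonneg (hp1.pos x).le (sq_nonneg _)) ((integrable_law_iff hp1 hpc).1 hint)] at hz
  have hcont : Continuous fun x => p1 x * ‖gradLog p1 x - gradLog pInf x‖ ^ 2 :=
    hpc.mul ((hreg1.differentiable_score.continuous.sub
      hregInf.differentiable_score.continuous).norm.pow 2)
  have hall := (Continuous.ae_eq_iff_eq volume hcont continuous_const).1 hz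
  have hgrad : ∀ x, gradLog p1 x = gradLog pInf x := fun x => by
    have : p1 x * ‖gradLog p1 x - gradLog pInf x‖ ^ 2 = 0 := congrFun hall x
    simpa [(hp1.pos x).ne', sub_eq_zero] using this
  have hd1 : Differentiable ℝ fun x => Real.log (p1 x) :=
    hreg1.differentiable_data.log fun x => (hp1.pos x).ne'
  have hdI : Differentiable ℝ fun x => Real.log (pInf x) :=
    hregInf.differentiable_model.log fun x => (hpInf.pos x).ne'
  have hconst : ∀ x, Real.log (p1 x) - Real.log (pInf x) =
      Real.log (p1 0) - Real.log (pInf 0) := by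
    refine fun x => is_const_of_fderiv_eq_zero (𝕜 := ℝ) (hd1.sub hdI) (fun y => ?_) x 0
    rw [fderiv_sub (hd1 y) (hdI y), sub_eq_zero]
    ext v
    rw [← inner_gradient_left, ← inner_gradient_left]
    exact congrArg (inner ℝ · v) (hgrad y)
  set c := Real.exp (Real.log (p1 0) - Real.log (pInf 0)) with hc
  have hmul : ∀ x, p1 x = c * pInf x := fun x => by
    rw [hc, ← hconst x, Real.exp_sub, Real.exp_log (hp1.pos x), Real.exp_log (hpInf.pos x),
      div_mul_cancel₀ _ (hpInf.pos x).ne']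
  have hc1 : ENNReal.ofReal c = 1 := by
    have := hp1.lintegral_eq_one
    have hcn : 0 ≤ c := (Real.exp_pos _).le
    simp only [hmul, ENNReal.ofReal_mul hcn] at this
    rwa [lintegral_const_mul' _ _ ENNReal.ofReal_ne_top, hpInf.lintegral_eq_one, mul_one] at this
  have hc1' : c = 1 := by simpa using hc1
  have : p1 = pInf := funext fun x => by rw [hmul, hc1', one_mul]
  rw [this]

/-! ### Tail events of the stopping time and the false alarm bound -/

theorem toENNReal_eq_tsum (t : ℕ∞) : (t : ℝ≥0∞) = ∑' n : ℕ, if (n : ℕ∞) < t then 1 else 0 := by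
  induction t using ENat.recTopCoe with
  | top => simp
  | coe m =>
    rw [tsum_eq_sum (s := Finset.range m)]
    · rw [Finset.sum_congr rfl (g := fun _ => (1 : ℝ≥0∞))]
      · simp
      · intro n hn
        simpa using hn
    · intro n hn
      simpa using hn

theorem lt_stoppingTime_iff {Ω E : Type*} (z : E → ℝ) (τ : ℝ) (X : ℕ → Ω → E) (ω : Ω) (n : ℕ) :
    (n : ℕ∞) < stoppingTime z τ X ω ↔
      ∀ m ∈ Finset.Icc 1 n, ∀ k ∈ Finset.Icc 1 m, ∑ i ∈ Finset.Icc k m, z (X i ω) < τ := by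
  constructor
  · intro h m hm k hk
    by_contra! hle
    have h1 : stoppingTime z τ X ω ≤ (m : ℕ∞) :=
      sInf_le ⟨m, ⟨(Finset.mem_Icc.1 hm).1, k, hk, hle⟩, rfl⟩
    have h2 : (m : ℕ∞) ≤ n := by exact_mod_cast (Finset.mem_Icc.1 hm).2
    exact (h.trans_le (h1.trans h2)).false
  · intro h
    have : ((n + 1 : ℕ) : ℕ∞) ≤ stoppingTime z τ X ω := by
      refine le_sInf ?_
      rintro _ ⟨m, ⟨hm, k, hk, hle⟩, rfl⟩
      by_contra! hlt
      have hlt' : m < n + 1 := by exact_mod_cast hlt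
      exact (h m (Finset.mem_Icc.2 ⟨hm, by omega⟩) k hk).not_ge hle
    exact lt_of_lt_of_le (by exact_mod_cast n.lt_succ_self) this

theorem zero_lt_stoppingTime {Ω E : Type*} (z : E → ℝ) (τ : ℝ) (X : ℕ → Ω → E) (ω : Ω) :
    0 < stoppingTime z τ X ω := by
  have := (lt_stoppingTime_iff z τ X ω 0).2 (by simp)
  simpa using this

/-- The Shiryaev–Roberts statistic. -/
noncomputable def shiryaevRoberts {Ω E : Type*} (z : E → ℝ) (X : ℕ → Ω → E) : ℕ → Ω → ℝ≥0∞
  | 0, _ => 0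
  | n + 1, ω => (1 + shiryaevRoberts z X n ω) * ENNReal.ofReal (Real.exp (z (X (n + 1) ω)))

/-- Unrolled, the recursion is `R_n = ∑_{k ≤ n} exp (∑_{i=k}^n z (X i))`, a sum of nonnegative
terms. -/
theorem exp_sum_le_shiryaevRoberts {Ω E : Type*} (z : E → ℝ) (X : ℕ → Ω → E) (ω : Ω) (n : ℕ) :
    ∀ k ∈ Finset.Icc 1 n, ENNReal.ofReal (Real.exp (∑ i ∈ Finset.Icc k n, z (X i ω))) ≤
      shiryaevRoberts z X n ω := by
  induction n with
  | zero => simp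
  | succ n ih =>
    intro k hk
    rw [Finset.mem_Icc] at hk
    rw [Finset.sum_Icc_succ_top hk.2, Real.exp_add, ENNReal.ofReal_mul (Real.exp_pos _).le,
      shiryaevRoberts]
    gcongr
    rcases hk.2.eq_or_lt with rfl | h
    · simp
    · exact (ih k (Finset.mem_Icc.2 ⟨hk.1, by omega⟩)).trans le_add_self

section

variable {Ω E : Type*} [MeasurableSpace E] {z : E → ℝ} {X : ℕ → Ω → E}

theorem measurableSet_lt_stoppingTime {m0 : MeasurableSpace Ω} (hz : Measurable z) (τ : ℝ) (n : ℕ)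
    (hX : ∀ i ∈ Finset.Icc 1 n, Measurable (X i)) :
    MeasurableSet {ω | (n : ℕ∞) < stoppingTime z τ X ω} := by
  simp only [lt_stoppingTime_iff, Set.ofPred_forall]
  refine Finset.measurableSet_biInter _ fun m hm => Finset.measurableSet_biInter _ fun k hk => ?_
  refine measurableSet_lt (Finset.measurable_sum _ fun i hi => hz.comp (hX i ?_)) measurable_const
  simp only [Finset.mem_Icc] at *
  omega

theorem measurable_pastSigma {i n : ℕ} (h : i ∈ Finset.Icc 1 n) :
    Measurable[pastSigma X n] (X i) :=
  Measurable.of_comap_le (le_iSup₂_of_le (f := fun i (_ : i ∈ Finset.Icc 1 n) =>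
    MeasurableSpace.comap (X i) inferInstance) i h le_rfl)

theorem pastSigma_le {mΩ : MeasurableSpace Ω} (hX : ∀ n, 1 ≤ n → Measurable (X n)) (n : ℕ) :
    pastSigma X n ≤ mΩ :=
  iSup₂_le fun i hi => (hX i (Finset.mem_Icc.1 hi).1).comap_le

/-- The `σ`-algebra generated by `X (n + 1), X (n + 2), …`. -/
abbrev futureSigma (X : ℕ → Ω → E) (n : ℕ) : MeasurableSpace Ω :=
  ⨆ i ∈ Set.Ici (n + 1), MeasurableSpace.comap (X i) inferInstance

theorem measurable_futureSigma {i n : ℕ} (h : n + 1 ≤ i) :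
    Measurable[futureSigma X n] (X i) :=
  Measurable.of_comap_le (le_iSup₂_of_le (f := fun i (_ : i ∈ Set.Ici (n + 1)) =>
    MeasurableSpace.comap (X i) inferInstance) i h le_rfl)

theorem futureSigma_le {mΩ : MeasurableSpace Ω} (hX : ∀ n, 1 ≤ n → Measurable (X n)) (n : ℕ) :
    futureSigma X n ≤ mΩ :=
  iSup₂_le fun i hi => (hX i (le_add_self.trans hi)).comap_le

theorem measurable_shiryaevRoberts {m0 : MeasurableSpace Ω} (hz : Measurable z) (n : ℕ)
    (hX : ∀ i ∈ Finset.Icc 1 n, Measurable (X i)) : Measurable (shiryaevRoberts z X n) := by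
  induction n with
  | zero => exact measurable_const
  | succ n ih =>
    have h1 := ih fun i hi => hX i (by simp at hi ⊢; omega)
    have h2 := hz.comp (hX (n + 1) (by simp))
    exact (measurable_const.add h1).mul (Real.measurable_exp.comp h2).ennreal_ofReal

variable [MeasurableSpace Ω] {μ : Measure Ω}

theorem indep_pastSigma_futureSigma (hX : ∀ n, 1 ≤ n → Measurable (X n))
    (hind : iIndepFun (fun n : ℕ => X (n + 1)) μ) (n : ℕ) :
    Indep (pastSigma X n) (futureSigma X n) μ := by
  have h := indep_iSup_of_disjoint (m := fun j : ℕ => MeasurableSpace.comap (X (j + 1)) inferInstance)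
    (fun j => (hX (j + 1) le_add_self).comap_le) hind (S := Set.Iio n) (T := Set.Ici n)
    (Set.disjoint_left.2 fun j h1 h2 => (Set.mem_Iio.1 h1).not_ge h2)
  refine indep_of_indep_of_le_left (indep_of_indep_of_le_right h ?_) ?_
  · refine iSup₂_le fun i hi => ?_
    obtain ⟨j, rfl⟩ : ∃ j, i = j + 1 := ⟨i - 1, by simp at hi; omega⟩
    exact le_iSup₂_of_le (f := fun j (_ : j ∈ Set.Ici n) =>
      MeasurableSpace.comap (X (j + 1)) inferInstance) j (by simpa using hi) le_rfl
  · refine iSup₂_le fun i hi => ?_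
    obtain ⟨j, rfl⟩ : ∃ j, i = j + 1 := ⟨i - 1, by simp at hi; omega⟩
    exact le_iSup₂_of_le (f := fun j (_ : j ∈ Set.Iio n) =>
      MeasurableSpace.comap (X (j + 1)) inferInstance) j (by simp at hi ⊢; omega) le_rfl

theorem expTime_stoppingTime_eq_tsum (hz : Measurable z) (hX : ∀ n, 1 ≤ n → Measurable (X n))
    (τ : ℝ) :
    expTime μ (stoppingTime z τ X) = ∑' n : ℕ, μ {ω | (n : ℕ∞) < stoppingTime z τ X ω} := by
  have hA : ∀ n : ℕ, MeasurableSet {ω | (n : ℕ∞) < stoppingTime z τ X ω} := fun n =>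
    measurableSet_lt_stoppingTime hz τ n fun i hi => hX i (Finset.mem_Icc.1 hi).1
  have h : ∀ ω, ((stoppingTime z τ X ω : ℕ∞) : ℝ≥0∞) =
      ∑' n : ℕ, {ω | (n : ℕ∞) < stoppingTime z τ X ω}.indicator 1 ω := by
    intro ω
    rw [toENNReal_eq_tsum]
    simp only [Set.indicator_apply, Set.mem_ofPred_eq, Pi.one_apply]
  unfold expTime
  simp only [h]
  rw [lintegral_tsum fun n => (measurable_one.indicator (hA n)).aemeasurable]
  simp only [lintegral_indicator_one (hA _)]

/-- The supermartingale property of `R_n - n`, tested on past events: the new factor is independent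
of the past and has mean at most one. -/
theorem setLIntegral_shiryaevRoberts_succ_le (hz : Measurable z)
    (hX : ∀ n, 1 ≤ n → Measurable (X n)) (hind : iIndepFun (fun n : ℕ => X (n + 1)) μ)
    (n : ℕ) (hexp : ∫⁻ ω, ENNReal.ofReal (Real.exp (z (X (n + 1) ω))) ∂μ ≤ 1)
    {A : Set Ω} (hA : MeasurableSet[pastSigma X n] A) :
    ∫⁻ ω in A, shiryaevRoberts z X (n + 1) ω ∂μ ≤
      μ A + ∫⁻ ω in A, shiryaevRoberts z X n ω ∂μ := by
  have hA' := pastSigma_le hX n A hA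
  have hR : Measurable[pastSigma X n] (shiryaevRoberts z X n) :=
    measurable_shiryaevRoberts hz n fun i hi => measurable_pastSigma hi
  have hf : Measurable[pastSigma X n] (A.indicator fun ω => 1 + shiryaevRoberts z X n ω) :=
    (measurable_const.add hR).indicator hA
  have hg : Measurable[futureSigma X n] fun ω => ENNReal.ofReal (Real.exp (z (X (n + 1) ω))) :=
    (Real.measurable_exp.comp (hz.comp (measurable_futureSigma le_rfl))).ennreal_ofReal
  have key := lintegral_mul_eq_lintegral_mul_lintegral_of_independent_measurableSpace
    (pastSigma_le hX n) (futureSigma_le hX n) (indep_pastSigma_futureSigma hX hind n) hf hg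
  calc ∫⁻ ω in A, shiryaevRoberts z X (n + 1) ω ∂μ
      = ∫⁻ ω, A.indicator (fun ω => 1 + shiryaevRoberts z X n ω) ω *
          ENNReal.ofReal (Real.exp (z (X (n + 1) ω))) ∂μ := by
        rw [← lintegral_indicator hA']
        refine lintegral_congr fun ω => ?_
        by_cases h : ω ∈ A <;> simp [h, shiryaevRoberts]
    _ ≤ ∫⁻ ω, A.indicator (fun ω => 1 + shiryaevRoberts z X n ω) ω ∂μ := by
        rw [key]
        exact mul_le_of_le_one_right' hexp
    _ = μ A + ∫⁻ ω in A, shiryaevRoberts z X n ω ∂μ := by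
        rw [lintegral_indicator hA', lintegral_add_left measurable_const]
        simp

/-- Optional stopping done by hand at `min(T, N)`, where `E[min(T, N)] = ∑_{n < N} μ(T > n)`. -/
theorem le_expTime_stoppingTime [IsProbabilityMeasure μ] (hz : Measurable z)
    (hX : ∀ n, 1 ≤ n → Measurable (X n)) (hind : iIndepFun (fun n : ℕ => X (n + 1)) μ)
    (hexp : ∀ n, 1 ≤ n → ∫⁻ ω, ENNReal.ofReal (Real.exp (z (X n ω))) ∂μ ≤ 1) (τ : ℝ) :
    ENNReal.ofReal (Real.exp τ) ≤ expTime μ (stoppingTime z τ X) := by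
  rw [expTime_stoppingTime_eq_tsum hz hX]
  set A : ℕ → Set Ω := fun n => {ω | (n : ℕ∞) < stoppingTime z τ X ω} with hAdef
  have hA : ∀ n, MeasurableSet (A n) := fun n =>
    measurableSet_lt_stoppingTime hz τ n fun i hi => hX i (Finset.mem_Icc.1 hi).1
  have hanti : ∀ n, A (n + 1) ⊆ A n := fun n ω h =>
    lt_trans (show (n : ℕ∞) < ((n + 1 : ℕ) : ℕ∞) by exact_mod_cast n.lt_succ_self) h
  have hR : ∀ n, Measurable (shiryaevRoberts z X n) := fun n =>
    measurable_shiryaevRoberts hz n fun i hi => hX i (Finset.mem_Icc.1 hi).1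
  set c := ENNReal.ofReal (Real.exp τ)
  -- `A n \ A (n + 1)` is the event `T = n + 1`: some sum ending at `n + 1` has just reached `τ`, so
  -- `R_{n+1} ≥ exp τ` there.
  have hcross : ∀ n, c * μ (A n \ A (n + 1)) ≤
      ∫⁻ ω in A n \ A (n + 1), shiryaevRoberts z X (n + 1) ω ∂μ := by
    intro n
    rw [← setLIntegral_const]
    refine setLIntegral_mono (hR _) fun ω hω => ?_
    have h1 := (lt_stoppingTime_iff z τ X ω n).1 hω.1
    have h2 := fun h => hω.2 ((lt_stoppingTime_iff z τ X ω (n + 1)).2 h)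
    by_contra! hlt
    refine h2 fun m hm k hk => ?_
    rw [Finset.mem_Icc] at hm
    rcases hm.2.eq_or_lt with rfl | hmn
    · by_contra! hle
      refine hlt.not_ge (le_trans ?_ (exp_sum_le_shiryaevRoberts z X ω _ k hk))
      exact ENNReal.ofReal_le_ofReal (Real.exp_le_exp.2 hle)
    · exact h1 m (Finset.mem_Icc.2 ⟨hm.1, by omega⟩) k hk
  have hbound : ∀ N, c * μ (A N)ᶜ + ∫⁻ ω in A N, shiryaevRoberts z X N ω ∂μ ≤
      ∑ n ∈ Finset.range N, μ (A n) := by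
    intro N
    induction N with
    | zero =>
      have : A 0 = Set.univ := Set.eq_univ_of_forall fun ω => zero_lt_stoppingTime z τ X ω
      simp [this, shiryaevRoberts]
    | succ N ih =>
      have hcompl : (A (N + 1))ᶜ = (A N)ᶜ ∪ (A N \ A (N + 1)) := by
        ext ω
        have := @hanti N ω
        simp only [Set.mem_compl_iff, Set.mem_union, Set.mem_sdiff]
        tauto
      have hsplit : ∫⁻ ω in A N, shiryaevRoberts z X (N + 1) ω ∂μ =
          ∫⁻ ω in A N \ A (N + 1), shiryaevRoberts z X (N + 1) ω ∂μ +
          ∫⁻ ω in A (N + 1), shiryaevRoberts z X (N + 1) ω ∂μ := by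
        rw [← lintegral_union (hA _) Set.disjoint_sdiff_left, Set.sdiff_union_of_subset (hanti N)]
      have hstep := setLIntegral_shiryaevRoberts_succ_le hz hX hind N (hexp (N + 1) le_add_self)
        (A := A N) (measurableSet_lt_stoppingTime hz τ N fun i hi => measurable_pastSigma hi)
      rw [hsplit] at hstep
      rw [Finset.sum_range_succ]
      calc c * μ (A (N + 1))ᶜ + ∫⁻ ω in A (N + 1), shiryaevRoberts z X (N + 1) ω ∂μ
          ≤ c * (μ (A N)ᶜ + μ (A N \ A (N + 1))) +
            ∫⁻ ω in A (N + 1), shiryaevRoberts z X (N + 1) ω ∂μ := by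
            rw [hcompl]; gcongr; exact measure_union_le _ _
        _ ≤ c * μ (A N)ᶜ + (∫⁻ ω in A N \ A (N + 1), shiryaevRoberts z X (N + 1) ω ∂μ +
            ∫⁻ ω in A (N + 1), shiryaevRoberts z X (N + 1) ω ∂μ) := by
            rw [mul_add, add_assoc]; gcongr; exact hcross N
        _ ≤ c * μ (A N)ᶜ + (μ (A N) + ∫⁻ ω in A N, shiryaevRoberts z X N ω ∂μ) := by gcongr
        _ = (c * μ (A N)ᶜ + ∫⁻ ω in A N, shiryaevRoberts z X N ω ∂μ) + μ (A N) := by ring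
        _ ≤ _ := by gcongr
  by_cases htop : ∑' n, μ (A n) = ⊤
  · rw [htop]; exact le_top
  -- A finite mean forces `μ(T > N) → 0`, which removes the unstopped part.
  have hle : ∀ N, c ≤ ∑' n, μ (A n) + c * μ (A N) := by
    intro N
    calc c = c * μ (A N)ᶜ + c * μ (A N) := by
          rw [← mul_add, add_comm, prob_add_prob_compl (hA N), mul_one]
      _ ≤ _ := by
          gcongr
          exact le_self_add.trans ((hbound N).trans (ENNReal.sum_le_tsum _))
  have hlim : Tendsto (fun N => ∑' n, μ (A n) + c * μ (A N)) atTop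
      (nhds (∑' n, μ (A n) + c * 0)) :=
    tendsto_const_nhds.add (ENNReal.Tendsto.const_mul
      (ENNReal.tendsto_atTop_zero_of_tsum_ne_top htop) (Or.inr ENNReal.ofReal_ne_top))
  simpa using ge_of_tendsto' hlim hle

end

/-! ### First passage times and upper bounds on the delays -/

/-- The event that the random walk `∑_{i=1}^m z (X i)` stays below `τ` for `1 ≤ m ≤ n`. -/
def belowUpTo {Ω E : Type*} (z : E → ℝ) (τ : ℝ) (X : ℕ → Ω → E) (n : ℕ) : Set Ω :=
  {ω | ∀ m ∈ Finset.Icc 1 n, ∑ i ∈ Finset.Icc 1 m, z (X i ω) < τ}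

/-- The first passage time of the random walk `∑_{i=1}^m z (X i)` over the level `τ`. -/
noncomputable def passageTime {Ω E : Type*} (z : E → ℝ) (τ : ℝ) (X : ℕ → Ω → E) (ω : Ω) : ℝ≥0∞ :=
  ∑' n, (belowUpTo z τ X n).indicator 1 ω

/-- The scan includes the starting index `ν + 1`, so no alarm by `ν + n` means the walk restarted
there is still below `τ`. -/
theorem stoppingTime_sub_le_passageTime {Ω E : Type*} (z : E → ℝ) (τ : ℝ) (X : ℕ → Ω → E)
    (ν : ℕ) (ω : Ω) :
    ((stoppingTime z τ X ω - (ν : ℕ∞) : ℕ∞) : ℝ≥0∞) ≤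
      passageTime z τ (fun i => X (ν + i)) ω := by
  rw [toENNReal_eq_tsum]
  refine ENNReal.tsum_le_tsum fun n => ?_
  split_ifs with h
  · have hlt : ((ν + n : ℕ) : ℕ∞) < stoppingTime z τ X ω := by
      have := lt_tsub_iff_left.1 h
      exact_mod_cast this
    have hmem : ω ∈ belowUpTo z τ (fun i => X (ν + i)) n := by
      intro m hm
      rw [Finset.mem_Icc] at hm
      have := (lt_stoppingTime_iff z τ X ω (ν + n)).1 hlt (ν + m)
        (Finset.mem_Icc.2 ⟨by omega, by omega⟩) (ν + 1) (Finset.mem_Icc.2 ⟨by omega, by omega⟩)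
      rwa [← Finset.map_add_left_Icc, Finset.sum_map] at this
    simp [hmem]
  · exact bot_le

/-- The sum is the truncated walk stopped at its first passage: before the last step it is at most
`τ`, and that step adds at most `b`. -/
theorem sum_indicator_min_le {Ω E : Type*} (z : E → ℝ) {τ b : ℝ} (hτ : 0 ≤ τ) (hb : 0 ≤ b)
    (X : ℕ → Ω → E) (ω : Ω) (N : ℕ) :
    ∑ n ∈ Finset.range N, (belowUpTo z τ X n).indicator 1 ω * min (z (X (n + 1) ω)) b ≤ τ + b := by
  -- The induction also carries that, before passage, truncation has only lowered the walk.
  suffices h : ∑ n ∈ Finset.range N,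
        (belowUpTo z τ X n).indicator 1 ω * min (z (X (n + 1) ω)) b ≤ τ + b ∧
      (ω ∈ belowUpTo z τ X N → ∑ n ∈ Finset.range N,
        (belowUpTo z τ X n).indicator 1 ω * min (z (X (n + 1) ω)) b ≤
          ∑ i ∈ Finset.Icc 1 N, z (X i ω)) from h.1
  induction N with
  | zero => simp; positivity
  | succ N ih =>
    rw [Finset.sum_range_succ, Finset.sum_Icc_succ_top (by omega)]
    by_cases hN : ω ∈ belowUpTo z τ X N
    · have h2 := ih.2 hN
      have h3 : ∑ i ∈ Finset.Icc 1 N, z (X i ω) ≤ τ := by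
        rcases Nat.eq_zero_or_pos N with rfl | hpos
        · simpa using hτ
        · exact (hN N (Finset.mem_Icc.2 ⟨hpos, le_rfl⟩)).le
      simp only [Set.indicator_of_mem hN, Pi.one_apply, one_mul]
      have h4 := min_le_left (z (X (N + 1) ω)) b
      have h5 := min_le_right (z (X (N + 1) ω)) b
      exact ⟨by linarith, fun _ => by linarith⟩
    · have hN' : ω ∉ belowUpTo z τ X (N + 1) := fun h => hN fun m hm =>
        h m (Finset.Icc_subset_Icc_right N.le_succ hm)
      simp only [Set.indicator_of_notMem hN, zero_mul, add_zero]
      exact ⟨ih.1, fun h => absurd h hN'⟩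

section

variable {Ω E : Type*} [MeasurableSpace E] {z : E → ℝ} {X : ℕ → Ω → E}

theorem measurableSet_belowUpTo {m0 : MeasurableSpace Ω} (hz : Measurable z) (τ : ℝ) (n : ℕ)
    (hX : ∀ i ∈ Finset.Icc 1 n, Measurable (X i)) :
    MeasurableSet (belowUpTo z τ X n) := by
  simp only [belowUpTo, Set.ofPred_forall]
  refine Finset.measurableSet_biInter _ fun m hm => ?_
  refine measurableSet_lt (Finset.measurable_sum _ fun i hi => hz.comp (hX i ?_)) measurable_const
  simp only [Finset.mem_Icc] at *
  omega

theorem measurable_passageTime {m0 : MeasurableSpace Ω} (hz : Measurable z) (τ : ℝ)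
    (hX : ∀ i, 1 ≤ i → Measurable (X i)) : Measurable (passageTime z τ X) :=
  Measurable.tsum fun n => measurable_one.indicator
    (measurableSet_belowUpTo hz τ n fun i hi => hX i (Finset.mem_Icc.1 hi).1)

variable [MeasurableSpace Ω] {μ : Measure Ω} {ρ : Measure E}

theorem integrable_min_const [IsProbabilityMeasure ρ] (hz : Integrable z ρ) (b : ℝ) :
    Integrable (fun x => min (z x) b) ρ :=
  hz.inf (integrable_const b)

/-- Cutting only from above keeps `|min (z x) b| ≤ |z x|`, so a first moment suffices, and a
positive drift survives truncation at some `b`. -/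
theorem tendsto_integral_min_natCast [IsProbabilityMeasure ρ] (hz : Integrable z ρ) :
    Tendsto (fun b : ℕ => ∫ x, min (z x) b ∂ρ) atTop (nhds (∫ x, z x ∂ρ)) := by
  refine tendsto_integral_of_dominated_convergence (fun x => |z x|)
    (fun b => (integrable_min_const hz b).aestronglyMeasurable) hz.abs
    (fun b => ae_of_all _ fun x => ?_) (ae_of_all _ fun x => ?_)
  · have hb : (0 : ℝ) ≤ b := b.cast_nonneg
    rw [Real.norm_eq_abs, abs_le]
    refine ⟨le_min (neg_abs_le _) ?_, (min_le_left _ _).trans (le_abs_self _)⟩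
    linarith [abs_nonneg (z x)]
  · refine tendsto_const_nhds.congr' ?_
    filter_upwards [eventually_ge_atTop ⌈z x⌉₊] with b hb
    exact (min_eq_left ((Nat.le_ceil _).trans (by exact_mod_cast hb))).symm

/-- Wald's identity for truncated increments bounds the mean first passage time. -/
theorem lintegral_passageTime_le [IsProbabilityMeasure μ] [IsProbabilityMeasure ρ]
    (hz : Measurable z) (hzi : Integrable z ρ) (hX : ∀ n, 1 ≤ n → Measurable (X n))
    (hind : iIndepFun (fun n : ℕ => X (n + 1)) μ) (hlaw : ∀ n, 1 ≤ n → μ.map (X n) = ρ)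
    {τ b : ℝ} (hτ : 0 ≤ τ) (hb : 0 ≤ b) (hpos : 0 < ∫ x, min (z x) b ∂ρ) :
    ∫⁻ ω, passageTime z τ X ω ∂μ ≤ ENNReal.ofReal ((τ + b) / ∫ x, min (z x) b ∂ρ) := by
  set mb := ∫ x, min (z x) b ∂ρ
  have hD : ∀ n, MeasurableSet (belowUpTo z τ X n) := fun n =>
    measurableSet_belowUpTo hz τ n fun i hi => hX i (Finset.mem_Icc.1 hi).1
  have hzb : Measurable fun x => min (z x) b := hz.min measurable_const
  have hprod : ∀ n, Integrable (fun ω => (belowUpTo z τ X n).indicator 1 ω *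
        min (z (X (n + 1) ω)) b) μ ∧
      ∫ ω, (belowUpTo z τ X n).indicator 1 ω * min (z (X (n + 1) ω)) b ∂μ =
        μ.real (belowUpTo z τ X n) * mb := by
    intro n
    have hXn := hX (n + 1) le_add_self
    have hint : Integrable (fun ω => min (z (X (n + 1) ω)) b) μ := by
      have := integrable_min_const hzi b
      rw [← hlaw (n + 1) le_add_self] at this
      exact this.comp_measurable hXn
    have hmean : ∫ ω, min (z (X (n + 1) ω)) b ∂μ = mb := by
      rw [← integral_map hXn.aemeasurable (f := fun x => min (z x) b) hzb.aestronglyMeasurable,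
        hlaw (n + 1) le_add_self]
    have h1 : Integrable ((belowUpTo z τ X n).indicator (1 : Ω → ℝ)) μ :=
      (integrable_const (1 : ℝ)).indicator (hD n)
    -- Whether the walk is still below `τ` at time `n` is decided by `X 1, …, X n`, hence
    -- independent of the next increment.
    have hi : IndepFun ((belowUpTo z τ X n).indicator (1 : Ω → ℝ))
        (fun ω => min (z (X (n + 1) ω)) b) μ := by
      rw [IndepFun_iff_Indep]
      refine indep_of_indep_of_le_left (indep_of_indep_of_le_right
        (indep_pastSigma_futureSigma hX hind n) ?_) ?_
      · exact (hzb.comp (measurable_futureSigma le_rfl)).comap_le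
      · refine Measurable.comap_le (Measurable.indicator (measurable_const (a := (1 : ℝ))) ?_)
        exact measurableSet_belowUpTo hz τ n fun i hi => measurable_pastSigma hi
    refine ⟨hi.integrable_mul h1 hint, ?_⟩
    have := hi.integral_mul_eq_mul_integral h1.aestronglyMeasurable hint.aestronglyMeasurable
    rw [hmean, integral_indicator_one (hD n)] at this
    exact this
  have hsum : ∀ N, ∑ n ∈ Finset.range N, μ.real (belowUpTo z τ X n) ≤ (τ + b) / mb := by
    intro N
    rw [le_div_iff₀ hpos, Finset.sum_mul, Finset.sum_congr rfl fun n _ => (hprod n).2.symm,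
      ← integral_finsetSum _ fun n _ => (hprod n).1]
    calc _ ≤ ∫ _, (τ + b) ∂μ := integral_mono (integrable_finsetSum _ fun n _ => (hprod n).1)
          (integrable_const _) fun ω => sum_indicator_min_le z hτ hb X ω N
      _ = τ + b := by simp
  unfold passageTime
  rw [lintegral_tsum fun n => (measurable_one.indicator (hD n)).aemeasurable]
  simp only [lintegral_indicator_one (hD _)]
  rw [ENNReal.tsum_eq_iSup_nat]
  refine iSup_le fun N => ?_
  rw [Finset.sum_congr rfl fun n _ => (ofReal_measureReal (μ := μ)
    (s := belowUpTo z τ X n)).symm, ← ENNReal.ofReal_sum_of_nonneg fun _ _ => measureReal_nonneg]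
  exact ENNReal.ofReal_le_ofReal (hsum N)

/-- The restarted walk is independent of `F_ν`, so its passage time integrates over a past event as
a product. Both delay criteria reduce to this. -/
theorem setLIntegral_passageTime_shift_le [IsProbabilityMeasure μ] [IsProbabilityMeasure ρ]
    (hz : Measurable z) (hzi : Integrable z ρ) (hX : ∀ n, 1 ≤ n → Measurable (X n))
    (hind : iIndepFun (fun n : ℕ => X (n + 1)) μ) (ν : ℕ)
    (hlaw : ∀ n, ν + 1 ≤ n → μ.map (X n) = ρ)
    {τ b : ℝ} (hτ : 0 ≤ τ) (hb : 0 ≤ b) (hpos : 0 < ∫ x, min (z x) b ∂ρ)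
    {s : Set Ω} (hs : MeasurableSet[pastSigma X ν] s) :
    ∫⁻ ω in s, passageTime z τ (fun i => X (ν + i)) ω ∂μ ≤
      ENNReal.ofReal ((τ + b) / ∫ x, min (z x) b ∂ρ) * μ s := by
  have hs' := pastSigma_le hX ν s hs
  have hbound := lintegral_passageTime_le (μ := μ) (ρ := ρ) (X := fun i => X (ν + i)) hz hzi
    (fun n hn => hX _ (by omega))
    (hind.precomp (g := fun n => ν + n) fun a b h => by simpa using h)
    (fun n hn => hlaw _ (by omega)) hτ hb hpos
  have hf : Measurable[pastSigma X ν] (s.indicator fun _ => (1 : ℝ≥0∞)) :=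
    measurable_const.indicator hs
  have hg : Measurable[futureSigma X ν] (passageTime z τ fun i => X (ν + i)) :=
    measurable_passageTime hz τ fun i hi => measurable_futureSigma (by omega)
  have key := lintegral_mul_eq_lintegral_mul_lintegral_of_independent_measurableSpace
    (pastSigma_le hX ν) (futureSigma_le hX ν) (indep_pastSigma_futureSigma hX hind ν) hf hg
  calc ∫⁻ ω in s, passageTime z τ (fun i => X (ν + i)) ω ∂μ
      = ∫⁻ ω, s.indicator 1 ω * passageTime z τ (fun i => X (ν + i)) ω ∂μ := by
        rw [← lintegral_indicator hs']
        refine lintegral_congr fun ω => ?_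
        by_cases h : ω ∈ s <;> simp [h]
    _ = μ s * ∫⁻ ω, passageTime z τ (fun i => X (ν + i)) ω ∂μ := by
        rw [← lintegral_indicator_one hs']
        exact key
    _ ≤ _ := by rw [mul_comm]; gcongr

theorem expTime_stoppingTime_le [IsProbabilityMeasure μ] [IsProbabilityMeasure ρ]
    (hz : Measurable z) (hzi : Integrable z ρ) (hX : ∀ n, 1 ≤ n → Measurable (X n))
    (hind : iIndepFun (fun n : ℕ => X (n + 1)) μ) (hlaw : ∀ n, 1 ≤ n → μ.map (X n) = ρ)
    {τ b : ℝ} (hτ : 0 ≤ τ) (hb : 0 ≤ b) (hpos : 0 < ∫ x, min (z x) b ∂ρ) :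
    expTime μ (stoppingTime z τ X) ≤ ENNReal.ofReal ((τ + b) / ∫ x, min (z x) b ∂ρ) := by
  refine (lintegral_mono fun ω => ?_).trans
    (lintegral_passageTime_le hz hzi hX hind hlaw hτ hb hpos)
  simpa using stoppingTime_sub_le_passageTime z τ X 0 ω

/-- After the change point, the conditional mean delay is bounded by the mean of a first passage
time that is independent of the past. -/
theorem essSup_condLExp_delay_le [IsProbabilityMeasure μ] [IsProbabilityMeasure ρ]
    (hz : Measurable z) (hzi : Integrable z ρ) (hX : ∀ n, 1 ≤ n → Measurable (X n))
    (hind : iIndepFun (fun n : ℕ => X (n + 1)) μ) (ν : ℕ)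
    (hlaw : ∀ n, ν + 1 ≤ n → μ.map (X n) = ρ)
    {τ b : ℝ} (hτ : 0 ≤ τ) (hb : 0 ≤ b) (hpos : 0 < ∫ x, min (z x) b ∂ρ) :
    essSup (condLExp (pastSigma X ν) μ fun ω =>
      ((stoppingTime z τ X ω + 1 - (ν : ℕ∞) : ℕ∞) : ℝ≥0∞)) μ ≤
        1 + ENNReal.ofReal ((τ + b) / ∫ x, min (z x) b ∂ρ) := by
  have hm := pastSigma_le hX ν
  refine essSup_le_of_ae_le _ (ae_le_of_ae_le_trim (hm := hm) ?_)
  -- Both sides are `F_ν`-measurable, so it suffices to compare integrals over events of `F_ν`.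
  refine ae_le_of_forall_setLIntegral_le_of_sigmaFinite (μ := μ.trim hm)
    (measurable_condLExp _ _ _) fun s hs _ => ?_
  rw [setLIntegral_condLExp_trim hm _ _ hs, setLIntegral_const, trim_measurableSet_eq hm hs]
  calc _ ≤ ∫⁻ ω in s, (1 + passageTime z τ (fun i => X (ν + i)) ω) ∂μ := by
        refine lintegral_mono fun ω => ?_
        have h : stoppingTime z τ X ω + 1 - (ν : ℕ∞) ≤ 1 + (stoppingTime z τ X ω - (ν : ℕ∞)) := by
          rw [tsub_le_iff_right, add_assoc, add_comm 1]
          calc stoppingTime z τ X ω + 1 ≤ (stoppingTime z τ X ω - ν + ν) + 1 := by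
                gcongr; exact le_tsub_add
            _ = _ := by ring
        refine (ENat.toENNReal_le.2 h).trans ?_
        rw [ENat.toENNReal_add, ENat.toENNReal_one]
        gcongr
        exact stoppingTime_sub_le_passageTime z τ X ν ω
    _ ≤ _ := by
        rw [lintegral_add_left measurable_const, setLIntegral_const, one_mul, add_mul, one_mul]
        gcongr
        exact setLIntegral_passageTime_shift_le hz hzi hX hind ν hlaw hτ hb hpos hs

/-- The conditioning event `T ≥ ν` is decided by the first `ν - 1` observations, hence lies in
`F_ν`. -/
theorem expTime_cond_delay_le [IsProbabilityMeasure μ] [IsProbabilityMeasure ρ]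
    (hz : Measurable z) (hzi : Integrable z ρ) (hX : ∀ n, 1 ≤ n → Measurable (X n))
    (hind : iIndepFun (fun n : ℕ => X (n + 1)) μ) (ν : ℕ) (hν : 1 ≤ ν)
    (hlaw : ∀ n, ν + 1 ≤ n → μ.map (X n) = ρ)
    {τ b : ℝ} (hτ : 0 ≤ τ) (hb : 0 ≤ b) (hpos : 0 < ∫ x, min (z x) b ∂ρ) :
    expTime (ProbabilityTheory.cond μ {ω | (ν : ℕ∞) ≤ stoppingTime z τ X ω})
      (fun ω => stoppingTime z τ X ω - (ν : ℕ∞)) ≤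
        ENNReal.ofReal ((τ + b) / ∫ x, min (z x) b ∂ρ) := by
  set A := {ω | (ν : ℕ∞) ≤ stoppingTime z τ X ω} with hA
  have hAm : MeasurableSet[pastSigma X ν] A := by
    obtain ⟨n, rfl⟩ : ∃ n, ν = n + 1 := ⟨ν - 1, by omega⟩
    have : A = {ω | (n : ℕ∞) < stoppingTime z τ X ω} := by
      ext ω
      simp only [hA, Set.mem_ofPred_eq, Nat.cast_add, Nat.cast_one]
      exact ENat.add_one_le_iff (ENat.natCast_ne_top n)
    rw [this]
    exact measurableSet_lt_stoppingTime hz τ n fun i hi =>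
      measurable_pastSigma (Finset.Icc_subset_Icc_right n.le_succ hi)
  unfold expTime
  rw [ProbabilityTheory.cond, lintegral_smul_measure, smul_eq_mul]
  calc _ ≤ (μ A)⁻¹ * (ENNReal.ofReal ((τ + b) / ∫ x, min (z x) b ∂ρ) * μ A) := by
        gcongr
        exact (lintegral_mono fun ω => stoppingTime_sub_le_passageTime z τ X ν ω).trans
          (setLIntegral_passageTime_shift_le hz hzi hX hind ν hlaw hτ hb hpos hAm)
    _ ≤ _ := by
        -- `(μ A)⁻¹ * μ A ≤ 1` also covers a null conditioning event, where the product is zero.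
        rw [mul_left_comm]
        exact mul_le_of_le_one_right' (ENNReal.inv_mul_le_one _)

end

/-! ### Lower bound from the strong law -/

theorem exists_abs_sub_le_of_tendsto_div {S : ℕ → ℝ} {m : ℝ}
    (h : Tendsto (fun n : ℕ => S n / n) atTop (nhds m)) {δ : ℝ} (hδ : 0 < δ) :
    ∃ C : ℕ, ∀ n : ℕ, |S n - n * m| ≤ n * δ + C := by
  obtain ⟨N, hN⟩ := Metric.tendsto_atTop.1 h δ hδ
  -- The constant absorbs the finitely many early deviations. It is natural so that the
  -- corresponding events form an increasing sequence.
  refine ⟨∑ n ∈ Finset.range (N + 1), ⌈|S n - n * m|⌉₊, fun n => ?_⟩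
  by_cases hn : n < N + 1
  · have h1 : ⌈|S n - n * m|⌉₊ ≤ ∑ n ∈ Finset.range (N + 1), ⌈|S n - n * m|⌉₊ :=
      Finset.single_le_sum (f := fun n : ℕ => ⌈|S n - n * m|⌉₊) (fun _ _ => Nat.zero_le _)
        (Finset.mem_range.2 hn)
    have h2 : (⌈|S n - n * m|⌉₊ : ℝ) ≤ (∑ n ∈ Finset.range (N + 1), ⌈|S n - n * m|⌉₊ : ℕ) := by
      exact_mod_cast h1
    have h3 := Nat.le_ceil |S n - n * m|
    have h4 : 0 ≤ n * δ := by positivity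
    linarith
  · have hn0 : (0 : ℝ) < n := by exact_mod_cast (by omega : 0 < n)
    have h1 := (hN n (by omega)).le
    rw [Real.dist_eq] at h1
    have h2 : S n - n * m = n * (S n / n - m) := by field_simp
    rw [h2, abs_mul, abs_of_pos hn0]
    have := mul_le_mul_of_nonneg_left h1 hn0.le
    linarith [(Nat.cast_nonneg _ :
      (0 : ℝ) ≤ (∑ n ∈ Finset.range (N + 1), ⌈|S n - n * m|⌉₊ : ℕ))]

/-- An alarm at `n ≤ N` started after `j` needs `τ ≤ S_n - S_j`, while the cone allows at most `(n -
j) m + (n + j) δ + 2 C ≤ N (m + 2 δ) + 2 C`. -/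
theorem le_stoppingTime_of_abs_sub_le {Ω E : Type*} {z : E → ℝ} {X : ℕ → Ω → E} {ω : Ω}
    {m δ C : ℝ} (hm : 0 ≤ m) (hδ : 0 < δ)
    (h : ∀ n : ℕ, |∑ i ∈ Finset.range n, z (X (i + 1) ω) - n * m| ≤ n * δ + C) (τ : ℝ) :
    ENNReal.ofReal ((τ - 2 * C) / (m + 2 * δ)) ≤ (stoppingTime z τ X ω : ℝ≥0∞) := by
  cases hT : stoppingTime z τ X ω using ENat.recTopCoe with
  | top => simp
  | coe N =>
    have hn : ¬ ((N : ℕ∞) < stoppingTime z τ X ω) := by simp [hT]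
    rw [lt_stoppingTime_iff] at hn
    push Not at hn
    obtain ⟨n, hnN, k, hk, hle⟩ := hn
    rw [Finset.mem_Icc] at hnN hk
    obtain ⟨j, rfl⟩ : ∃ j, k = j + 1 := ⟨k - 1, by omega⟩
    have hsum : ∑ i ∈ Finset.Icc (j + 1) n, z (X i ω) =
        ∑ i ∈ Finset.range n, z (X (i + 1) ω) - ∑ i ∈ Finset.range j, z (X (i + 1) ω) := by
      rw [← Finset.sum_Ico_eq_sub _ (by omega : j ≤ n), Finset.sum_Ico_add'
        (fun i => z (X i ω)) j n 1, Finset.Ico_add_one_right_eq_Icc]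
    rw [hsum] at hle
    have h1 := (abs_le.1 (h n)).2
    have h2 := (abs_le.1 (h j)).1
    have hjn : (j : ℝ) ≤ N := by exact_mod_cast (by omega : j ≤ N)
    have hnN' : (n : ℝ) ≤ N := by exact_mod_cast hnN.2
    have hjm : 0 ≤ j * m := by positivity
    have : (τ - 2 * C) / (m + 2 * δ) ≤ N := by
      rw [div_le_iff₀ (by positivity)]
      nlinarith [mul_le_mul_of_nonneg_right hjn hδ.le, mul_le_mul_of_nonneg_right hnN' hδ.le,
        mul_le_mul_of_nonneg_right hnN' hm]
    rw [ENat.toENNReal_coe]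
    exact (ENNReal.ofReal_le_ofReal this).trans (by simp)

/-- The cone constant from the strong law is random, but one deterministic value works with
probability above `1 - ε`, and it does not depend on `τ`. -/
theorem exists_le_expTime_stoppingTime {Ω E : Type*} [MeasurableSpace E] {z : E → ℝ}
    {X : ℕ → Ω → E} [MeasurableSpace Ω] {μ : Measure Ω} {ρ : Measure E} [IsProbabilityMeasure μ]
    (hz : Measurable z) (hzi : Integrable z ρ) (hX : ∀ n, 1 ≤ n → Measurable (X n))
    (hind : iIndepFun (fun n : ℕ => X (n + 1)) μ) (hlaw : ∀ n, 1 ≤ n → μ.map (X n) = ρ)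
    (hm : 0 ≤ ∫ x, z x ∂ρ) {ε : ℝ} (hε0 : 0 < ε) :
    ∃ C : ℝ, ∀ τ, ENNReal.ofReal (1 - ε) * ENNReal.ofReal ((τ - C) / (∫ x, z x ∂ρ + ε)) ≤
      expTime μ (stoppingTime z τ X) := by
  set m := ∫ x, z x ∂ρ with hmdef
  have hXs : ∀ n, Measurable (X (n + 1)) := fun n => hX (n + 1) le_add_self
  have hlaws : ∀ n, μ.map (X (n + 1)) = ρ := fun n => hlaw (n + 1) le_add_self
  have hmean : ∫ ω, z (X (0 + 1) ω) ∂μ = m := by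
    rw [← integral_map (hXs 0).aemeasurable (f := z) hz.aestronglyMeasurable, hlaws 0]
  have hslln := strong_law_ae_real (μ := μ) (fun n ω => z (X (n + 1) ω))
    (by rw [← hlaws 0] at hzi; exact hzi.comp_measurable (hXs 0))
    (fun i j hij => (hind.indepFun hij).comp hz hz)
    (fun i => IdentDistrib.comp ⟨(hXs i).aemeasurable, (hXs 0).aemeasurable,
      (hlaws i).trans (hlaws 0).symm⟩ hz)
  rw [hmean] at hslln
  let M : ℕ → Set Ω := fun C =>
    {ω | ∀ n : ℕ, |∑ i ∈ Finset.range n, z (X (i + 1) ω) - n * m| ≤ n * (ε / 2) + C}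
  have hMmeas : ∀ C, MeasurableSet (M C) := by
    intro C
    simp only [M, Set.ofPred_forall]
    refine MeasurableSet.iInter fun n => measurableSet_le ?_ measurable_const
    exact (((Finset.measurable_sum _ fun i _ => hz.comp (hXs i)).sub_const _)).abs
  have hMmono : Monotone M := fun C C' hCC ω h n =>
    (h n).trans (by gcongr)
  have hMU : μ (⋃ C, M C) = 1 := by
    rw [prob_compl_eq_zero_iff (MeasurableSet.iUnion hMmeas) |>.symm, ← mem_ae_iff]
    filter_upwards [hslln] with ω hω
    obtain ⟨C, hC⟩ := exists_abs_sub_le_of_tendsto_div hω (half_pos hε0)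
    exact Set.mem_iUnion.2 ⟨C, hC⟩
  have hlim := tendsto_measure_iUnion_atTop (μ := μ) hMmono
  rw [hMU] at hlim
  have hlt : ENNReal.ofReal (1 - ε) < 1 := by
    rw [ENNReal.ofReal_lt_one]; linarith
  obtain ⟨C, hC⟩ := (hlim.eventually (lt_mem_nhds hlt)).exists
  refine ⟨2 * C, fun τ => ?_⟩
  calc ENNReal.ofReal (1 - ε) * ENNReal.ofReal ((τ - 2 * C) / (m + ε))
      ≤ μ (M C) * ENNReal.ofReal ((τ - 2 * C) / (m + ε)) := by gcongr; exact hC.le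
    _ = ∫⁻ _ in M C, ENNReal.ofReal ((τ - 2 * C) / (m + ε)) ∂μ := by
        rw [setLIntegral_const, mul_comm]
    _ ≤ ∫⁻ ω in M C, (stoppingTime z τ X ω : ℝ≥0∞) ∂μ := by
        refine setLIntegral_mono' (hMmeas C) fun ω hω => ?_
        have := le_stoppingTime_of_abs_sub_le hm (half_pos hε0) hω τ
        rwa [mul_div_cancel₀ _ two_ne_zero] at this
    _ ≤ expTime μ (stoppingTime z τ X) := setLIntegral_le_lintegral _ _

/-! ### From affine bounds to asymptotic equivalence -/

theorem tendsto_affine_div_atTop (a c : ℝ) :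
    Tendsto (fun τ : ℝ => (a * τ + c) / τ) atTop (nhds a) := by
  have h : Tendsto (fun τ : ℝ => a + c / τ) atTop (nhds (a + 0)) :=
    tendsto_const_nhds.add (tendsto_const_nhds.div_atTop tendsto_id)
  rw [add_zero] at h
  refine h.congr' ?_
  filter_upwards [eventually_gt_atTop 0] with τ hτ
  field_simp

/-- After division by `τ` only the slopes `(1 - ε) / (m + ε)` and `1 / mb b` remain; both come
arbitrarily close to `1 / m`. -/
theorem tendsto_div_of_affine_bounds {f : ℝ → ℝ} {m : ℝ} (hm : 0 < m) {mb : ℕ → ℝ}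
    (hmb : Tendsto mb atTop (nhds m))
    (hlow : ∀ ε : ℝ, 0 < ε → ε < 1 →
      ∃ C : ℝ, ∀ᶠ τ in atTop, (1 - ε) * ((τ - C) / (m + ε)) - 1 ≤ f τ)
    (hup : ∀ b : ℕ, 0 < mb b → ∀ᶠ τ in atTop, f τ ≤ 1 + (τ + b) / mb b) :
    Tendsto (fun τ => f τ / τ) atTop (nhds m⁻¹) := by
  rw [tendsto_order]
  constructor
  · intro a ha
    have hcont : Tendsto (fun ε : ℝ => (1 - ε) / (m + ε)) (nhdsWithin 0 (Set.Ioi 0))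
        (nhds m⁻¹) := by
      have : ContinuousAt (fun ε : ℝ => (1 - ε) / (m + ε)) 0 := by
        refine ContinuousAt.div (by fun_prop) (by fun_prop) (by simpa using hm.ne')
      have h2 := this.tendsto.mono_left (nhdsWithin_le_nhds (s := Set.Ioi 0))
      simpa using h2
    obtain ⟨ε, hεa, hε0, hε1⟩ := ((hcont.eventually (lt_mem_nhds ha)).and
      (Ioo_mem_nhdsGT (show (0 : ℝ) < 1 by norm_num))).exists
    obtain ⟨C, hC⟩ := hlow ε hε0 hε1
    have hlim := tendsto_affine_div_atTop ((1 - ε) / (m + ε)) (-((1 - ε) * (C / (m + ε))) - 1)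
    filter_upwards [hC, hlim.eventually (lt_mem_nhds hεa), eventually_gt_atTop 0]
      with τ h1 h2 h3
    refine h2.trans_le ?_
    gcongr
    refine le_trans (le_of_eq ?_) h1
    ring
  · intro a ha
    have hinv := hmb.inv₀ hm.ne'
    obtain ⟨b, hba, hb0⟩ := ((hinv.eventually (gt_mem_nhds ha)).and
      (hmb.eventually (lt_mem_nhds hm))).exists
    have hlim := tendsto_affine_div_atTop (mb b)⁻¹ (1 + b / mb b)
    filter_upwards [hup b hb0, hlim.eventually (gt_mem_nhds hba), eventually_gt_atTop 0]
      with τ h1 h2 h3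
    refine lt_of_le_of_lt ?_ h2
    gcongr
    refine h1.trans (le_of_eq ?_)
    ring

/-- A delay that differs from the mean `g` of the stopping time by at most `1` from below, and
obeys the first passage bounds, is of order `τ / m`. -/
theorem tendsto_toReal_div_of_bounds {f g : ℝ → ℝ≥0∞} {m : ℝ} (hm : 0 < m) {mb : ℕ → ℝ}
    (hmb : Tendsto mb atTop (nhds m))
    (hg : ∀ ε : ℝ, 0 < ε → ∃ C : ℝ, ∀ τ,
      ENNReal.ofReal (1 - ε) * ENNReal.ofReal ((τ - C) / (m + ε)) ≤ g τ)
    (hgf : ∀ τ, g τ ≤ f τ + 1)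
    (hf : ∀ (b : ℕ) (τ : ℝ), 0 ≤ τ → 0 < mb b → f τ ≤ 1 + ENNReal.ofReal ((τ + b) / mb b)) :
    Tendsto (fun τ => (f τ).toReal / τ) atTop (nhds m⁻¹) := by
  -- A single admissible truncation level gives finiteness, without which `toReal` would not
  -- preserve the inequalities.
  obtain ⟨b₀, hb₀⟩ := (hmb.eventually (lt_mem_nhds hm)).exists
  have hfin : ∀ τ, 0 ≤ τ → f τ ≠ ⊤ := fun τ hτ =>
    ne_top_of_le_ne_top (by simp) (hf b₀ τ hτ hb₀)
  refine tendsto_div_of_affine_bounds hm hmb (fun ε hε0 hε1 => ?_) fun b hb => ?_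
  · obtain ⟨C, hC⟩ := hg ε hε0
    refine ⟨C, ?_⟩
    filter_upwards [eventually_ge_atTop 0] with τ hτ
    have h := (hC τ).trans (hgf τ)
    rw [← ENNReal.ofReal_mul (by linarith)] at h
    have h2 := ENNReal.toReal_mono (ENNReal.add_ne_top.2 ⟨hfin τ hτ, ENNReal.one_ne_top⟩) h
    rw [ENNReal.toReal_add (hfin τ hτ) ENNReal.one_ne_top, ENNReal.toReal_one] at h2
    have h3 := (le_max_left _ 0).trans (ENNReal.toReal_ofReal'.symm.le.trans h2)
    linarith
  · filter_upwards [eventually_ge_atTop 0] with τ hτ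
    have h := ENNReal.toReal_mono (by simp) (hf b τ hτ hb)
    rwa [ENNReal.toReal_add ENNReal.one_ne_top ENNReal.ofReal_ne_top, ENNReal.toReal_one,
      ENNReal.toReal_ofReal (by positivity)] at h

theorem isEquivalent_div_of_tendsto {f : ℝ → ℝ} {m : ℝ} (hm : 0 < m)
    (h : Tendsto (fun τ => f τ / τ) atTop (nhds m⁻¹)) :
    f ~[atTop] fun τ => τ / m := by
  refine (isEquivalent_iff_tendsto_one ?_).2 ?_
  · filter_upwards [eventually_gt_atTop 0] with τ hτ
    positivity
  · have := h.mul_const m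
    rw [inv_mul_cancel₀ hm.ne'] at this
    refine this.congr fun τ => ?_
    simp only [Pi.div_apply]
    field_simp

/-! ### Both delay criteria against the mean under `P 1` -/

namespace IsChangePointModel

variable {d : ℕ} {Ω : Type*} [MeasurableSpace Ω] {pInf p1 : EuclideanSpace ℝ (Fin d) → ℝ}
  {P : ℕ∞ → Measure Ω} {X : ℕ → Ω → EuclideanSpace ℝ (Fin d)}

theorem map_eq_law_of_le (hX : IsChangePointModel pInf p1 P X) {ν n : ℕ} (hν : 1 ≤ ν)
    (h : ν ≤ n) : (P (ν : ℕ∞)).map (X n) = law p1 :=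
  hX.law_after _ _ (by exact_mod_cast hν) (by exact_mod_cast h)

/-- For `ν = 1` the delay `T + 1 - ν` is `T` itself, and a mean is at most the essential supremum of
its conditional version. -/
theorem expTime_le_wadd (hX : IsChangePointModel pInf p1 P X) (T : Ω → ℕ∞) :
    expTime (P 1) T ≤ wadd P X T := by
  have := hX.isProbabilityMeasure 1 le_rfl
  have hm := pastSigma_le hX.measurable 1
  have h1 : expTime (P 1) T = ∫⁻ ω, condLExp (pastSigma X 1) (P 1)
      (fun ω => ((T ω + 1 - ((1 : ℕ) : ℕ∞) : ℕ∞) : ℝ≥0∞)) ω ∂(P 1) := by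
    rw [lintegral_condLExp hm]
    unfold expTime
    refine lintegral_congr fun ω => ?_
    rw [Nat.cast_one, (ENat.addLECancellable_of_ne_top ENat.one_ne_top).add_tsub_cancel_right]
  rw [h1]
  refine (lintegral_mono_ae (ENNReal.ae_le_essSup _)).trans ?_
  rw [lintegral_const, measure_univ, mul_one]
  have h2 := le_iSup₂ (f := fun (ν : ℕ) (_ : 1 ≤ ν) => essSup (condLExp (pastSigma X ν) (P ν)
    fun ω => ((T ω + 1 - (ν : ℕ∞) : ℕ∞) : ℝ≥0∞)) (P ν)) 1 le_rfl
  simpa only [wadd, Nat.cast_one] using h2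

/-- For `ν = 1` the conditioning is void since `T ≥ 1`, and the delay is `T - 1`. -/
theorem expTime_le_cadd_add_one (hX : IsChangePointModel pInf p1 P X) {T : Ω → ℕ∞}
    (hT : ∀ ω, 0 < T ω) : expTime (P 1) T ≤ cadd P T + 1 := by
  have := hX.isProbabilityMeasure 1 le_rfl
  have h2 := le_iSup₂ (f := fun (ν : ℕ) (_ : 1 ≤ ν) =>
    expTime (ProbabilityTheory.cond (P ν) {ω | (ν : ℕ∞) ≤ T ω}) fun ω => T ω - (ν : ℕ∞)) 1 le_rfl
  have huniv : {ω | (1 : ℕ∞) ≤ T ω} = Set.univ :=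
    Set.eq_univ_of_forall fun ω => Order.one_le_iff_ne_zero.2 (hT ω).ne'
  simp only [Nat.cast_one, huniv, cond_univ] at h2
  refine le_trans ?_ (add_le_add_left h2 1)
  calc expTime (P 1) T ≤ ∫⁻ ω, (((T ω - 1 : ℕ∞) : ℝ≥0∞) + 1) ∂(P 1) := by
        refine lintegral_mono fun ω => ?_
        rw [← ENat.toENNReal_one, ← ENat.toENNReal_add]
        exact ENat.toENNReal_le.2 le_tsub_add
    _ = _ := by
        rw [lintegral_add_right _ measurable_const]
        simp [expTime]

end IsChangePointModel

end SCUSUM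

/-! ### Assembly -/

theorem mainTheorem2 {d : ℕ} {Ω : Type*} [MeasurableSpace Ω]
    (pInf p1 : EuclideanSpace ℝ (Fin d) → ℝ)
    (hpInf : SCUSUM.IsPositiveDensity pInf) (hp1 : SCUSUM.IsPositiveDensity p1)
    (hne : SCUSUM.law p1 ≠ SCUSUM.law pInf)
    (hreg1 : SCUSUM.ScoreRegular p1 p1) (hregInf : SCUSUM.ScoreRegular p1 pInf)
    (P : ℕ∞ → Measure Ω) (X : ℕ → Ω → EuclideanSpace ℝ (Fin d))
    (hX : SCUSUM.IsChangePointModel pInf p1 P X)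
    (lam : ℝ) (hlam : 0 < lam)
    (hexp : ∫⁻ x, ENNReal.ofReal (Real.exp (SCUSUM.instScore pInf p1 lam x))
      ∂(SCUSUM.law pInf) ≤ 1)
    (T : ℝ → Ω → ℕ∞)
    (hT : ∀ γ : ℝ, T γ =
      SCUSUM.stoppingTime (SCUSUM.instScore pInf p1 lam) (Real.log γ) X) :
    (∀ γ : ℝ, 1 < γ → ENNReal.ofReal γ ≤ SCUSUM.expTime (P ⊤) (T γ)) ∧
    (fun γ => (SCUSUM.wadd P X (T γ)).toReal) ~[atTop]
      (fun γ => (SCUSUM.cadd P (T γ)).toReal) ∧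
    (fun γ => (SCUSUM.cadd P (T γ)).toReal) ~[atTop]
      (fun γ => (SCUSUM.expTime (P 1) (T γ)).toReal) ∧
    (fun γ => (SCUSUM.expTime (P 1) (T γ)).toReal) ~[atTop]
      (fun γ => Real.log γ / (lam * SCUSUM.fisherDivergence p1 pInf)) := by
  obtain rfl : T = fun γ => SCUSUM.stoppingTime (SCUSUM.instScore pInf p1 lam) (Real.log γ) X :=
    funext hT
  set z := SCUSUM.instScore pInf p1 lam with hzdef
  have hz : Measurable z := SCUSUM.measurable_instScore pInf p1 lam
  have hzi : Integrable z (SCUSUM.law p1) := SCUSUM.integrable_instScore hreg1 hregInf lam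
  have hρ := SCUSUM.isProbabilityMeasure_law hp1
  have hmean : ∫ x, z x ∂(SCUSUM.law p1) = lam * SCUSUM.fisherDivergence p1 pInf :=
    SCUSUM.integral_instScore hp1 hreg1 hregInf lam
  have hm : 0 < lam * SCUSUM.fisherDivergence p1 pInf :=
    mul_pos hlam (SCUSUM.fisherDivergence_pos hpInf hp1 hne hreg1 hregInf)
  have hmb := SCUSUM.tendsto_integral_min_natCast hzi
  rw [hmean] at hmb
  have hP1 := hX.isProbabilityMeasure 1 le_rfl
  have hind1 := hX.iIndepFun 1 le_rfl
  have hlaw1 : ∀ n : ℕ, 1 ≤ n → (P 1).map (X n) = SCUSUM.law p1 := fun n hn =>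
    hX.law_after 1 n le_rfl (by exact_mod_cast hn)
  have hlow : ∀ ε : ℝ, 0 < ε → ∃ C : ℝ, ∀ τ, ENNReal.ofReal (1 - ε) * ENNReal.ofReal
      ((τ - C) / (lam * SCUSUM.fisherDivergence p1 pInf + ε)) ≤
        SCUSUM.expTime (P 1) (SCUSUM.stoppingTime z τ X) := by
    intro ε hε
    have := SCUSUM.exists_le_expTime_stoppingTime hz hzi hX.measurable hind1 hlaw1
      (by rw [hmean]; exact hm.le) hε
    rwa [hmean] at this
  -- All three criteria satisfy the same two bounds, so each is equivalent to `τ / m`; substituting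
  -- `τ = log γ` makes them equivalent to one another.
  have hcomp : ∀ {f : ℝ → ℝ≥0∞},
      (∀ τ, SCUSUM.expTime (P 1) (SCUSUM.stoppingTime z τ X) ≤ f τ + 1) →
      (∀ (b : ℕ) (τ : ℝ), 0 ≤ τ → 0 < ∫ x, min (z x) b ∂(SCUSUM.law p1) →
        f τ ≤ 1 + ENNReal.ofReal ((τ + b) / ∫ x, min (z x) b ∂(SCUSUM.law p1))) →
      (fun γ => (f (Real.log γ)).toReal) ~[atTop]
        (fun γ => Real.log γ / (lam * SCUSUM.fisherDivergence p1 pInf)) := fun h1 h2 =>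
    (SCUSUM.isEquivalent_div_of_tendsto hm (SCUSUM.tendsto_toReal_div_of_bounds hm hmb hlow h1
      h2)).comp_tendsto Real.tendsto_log_atTop
  have hE := hcomp (f := fun τ => SCUSUM.expTime (P 1) (SCUSUM.stoppingTime z τ X))
    (fun τ => le_self_add) fun b τ hτ hb =>
      (SCUSUM.expTime_stoppingTime_le hz hzi hX.measurable hind1 hlaw1 hτ b.cast_nonneg hb).trans
        le_add_self
  have hW := hcomp (f := fun τ => SCUSUM.wadd P X (SCUSUM.stoppingTime z τ X))
    (fun τ => (hX.expTime_le_wadd _).trans le_self_add) fun b τ hτ hb => by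
      refine iSup₂_le fun ν hν => ?_
      have := hX.isProbabilityMeasure ν (by exact_mod_cast hν)
      exact SCUSUM.essSup_condLExp_delay_le hz hzi hX.measurable
        (hX.iIndepFun ν (by exact_mod_cast hν)) ν
        (fun n hn => hX.map_eq_law_of_le hν (by omega)) hτ b.cast_nonneg hb
  have hC := hcomp (f := fun τ => SCUSUM.cadd P (SCUSUM.stoppingTime z τ X))
    (fun τ => hX.expTime_le_cadd_add_one (SCUSUM.zero_lt_stoppingTime z τ X)) fun b τ hτ hb => by
      refine iSup₂_le fun ν hν => ?_
      have := hX.isProbabilityMeasure ν (by exact_mod_cast hν)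
      exact (SCUSUM.expTime_cond_delay_le hz hzi hX.measurable
        (hX.iIndepFun ν (by exact_mod_cast hν)) ν hν
        (fun n hn => hX.map_eq_law_of_le hν (by omega)) hτ b.cast_nonneg hb).trans le_add_self
  refine ⟨fun γ hγ => ?_, hW.trans hC.symm, hC.trans hE.symm, hE⟩
  have hPtop := hX.isProbabilityMeasure ⊤ le_top
  have h := SCUSUM.le_expTime_stoppingTime hz hX.measurable (hX.iIndepFun ⊤ le_top)
    (fun n hn => by
      rw [← hX.law_before ⊤ n hn (ENat.natCast_lt_top n), lintegral_map
        (f := fun x => ENNReal.ofReal (Real.exp (z x)))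
        (Real.measurable_exp.comp hz).ennreal_ofReal (hX.measurable n hn)] at hexp
      exact hexp) (Real.log γ)
  rwa [Real.exp_log (by linarith)] at h
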